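/- **Exponential tightness.** Let $c>1$, let $T\in(0,1)$ be the solution of $Te^{-T}=ce^{-c}$, and let $\theta>1-\frac Tc$. For $n>c$ and $k\ge 1$ let $P_k(\frac cn)$ be the probability that the Erdős–Rényi random graph on $k$ vertices with edge probability $\frac cn$ is connected, and put $$w_n(k)=\frac{n^{k-1}}{k!}\,P_k\!\left(\tfrac cn\right)\left(1-\tfrac cn\right)^{nk-k^2/2},\qquad Z_{n,c}=\sum_{1\le k\le\theta n}w_n(k).$$ For all large $n$, let $X^n_1,X^n_2,\dots$ be i.i.d. random variables with $\mathbb P(X^n_i=k)=w_n(k)/Z_{n,c}$ for $1\le k\le\theta n$ (and probability $0$ for other $k$), and let $N(Z_{n,c}n)$ be a Poisson random variable with mean $Z_{n,c}n$, independent of $(X_i^n)_{i\ge1}$ (the value at time $Z_{n,c}n$ of a rate one Poisson process). Let $(a_n)$ be a sequence of positive numbers with $(\log n)^{1/2}\ll a_n\ll\sqrt n$, where $u_n\ll v_n$ means $u_n/v_n\to0$. For $M>0$ let $$A_n(M)=\left\{\left|\max_{1\le i\le N(Z_{n,c}n)}X_i^n-\left(1-\tfrac Tc\right)n\right|\le Ma_n\sqrt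 n\right\}.$$ Then for every $M>0$ $$\limsup_{n\to\infty}\frac1{a_n^2}\log\mathbb P\left(A_n(M)^c\,\Big|\,\sum_{i=1}^{N(Z_{n,c}n)}X_i^n=n\right)\le-\frac{M^2}{2}\,\frac{(1-T)^2}{\left(1-\frac Tc\right)\frac Tc},$$ with the convention $\log 0=-\infty$. -/

import Mathlib

open MeasureTheory ProbabilityTheory Filter
open scoped ENNReal NNReal Topology

noncomputable section

namespace SparseGraph

/-- The probability that the Erdős–Rényi random graph on `k` labelled vertices, in which each of the
`k.choose 2` possible edges is present independently with probability `p`, is connected.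
The parameter `p` is clamped to the unit interval. -/
def connProb (k : ℕ) (p : ℝ) : ℝ :=
  (SimpleGraph.binomialRandom (Fin k) (Set.projIcc (0 : ℝ) 1 zero_le_one p)).real
    {G | G.Connected}

/-- The unnormalised weight of a jump of size `k ≥ 1`, with edge probability `c / n`. -/
def jumpWeight (c : ℝ) (n k : ℕ) : ℝ :=
  (n : ℝ) ^ (k - 1) / (k.factorial : ℝ) * connProb k (c / n) *
    (1 - c / n) ^ ((n : ℝ) * k - (k : ℝ) ^ 2 / 2)

/-- The admissible jump sizes: the integers `k` with `1 ≤ k ≤ θ n`. -/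
def jumpSizes (θ : ℝ) (n : ℕ) : Finset ℕ := Finset.Icc 1 ⌊θ * n⌋₊

/-- The normalising constant of the jump law (truncated at `θ n`). -/
def partitionZ (c θ : ℝ) (n : ℕ) : ℝ := ∑ k ∈ jumpSizes θ n, jumpWeight c n k

/-- The law of one jump: the size `k` has probability `jumpWeight c n k / partitionZ c θ n`
for `1 ≤ k ≤ θ n`, and all other sizes have probability zero. -/
def jumpLaw (c θ : ℝ) (n : ℕ) : Measure ℕ :=
  ∑ k ∈ jumpSizes θ n, ENNReal.ofReal (jumpWeight c n k / partitionZ c θ n) • Measure.dirac k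

/-- `N` is the number of jumps up to time `Z n` of a rate one Poisson process (a Poisson variable
with mean `Z n`), and `X 0, X 1, …` are i.i.d. jumps with the law `jumpLaw`, independent of `N`. -/
structure IsJumpModel (c θ : ℝ) (n : ℕ) {Ω : Type*} [MeasurableSpace Ω] (μ : Measure Ω)
    (N : Ω → ℕ) (X : ℕ → Ω → ℕ) : Prop where
  measurable_count : Measurable N
  measurable_jump : ∀ i, Measurable (X i)
  map_count : μ.map N = poissonMeasure (partitionZ c θ n * n).toNNReal
  map_jump : ∀ i, μ.map (X i) = jumpLaw c θ n
  indep_jumps : iIndepFun X μ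
  indep_count : IndepFun N (fun ω i => X i ω) μ

/-- The value of the compound Poisson process: the sum of the `N` jumps. -/
def totalJump {Ω : Type*} (N : Ω → ℕ) (X : ℕ → Ω → ℕ) (ω : Ω) : ℕ :=
  ∑ i ∈ Finset.range (N ω), X i ω

/-- The largest of the `N` jumps (zero if there is none). -/
def maxJump {Ω : Type*} (N : Ω → ℕ) (X : ℕ → Ω → ℕ) (ω : Ω) : ℕ :=
  (Finset.range (N ω)).sup fun i => X i ω

end SparseGraph

end

/-! Write ρ = 1 - T/c and q = 1 - c/n. Conditioned on their sum being n, the jumps behave like the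
component sizes of the random graph on n vertices with edge probability c/n, conditioned to have no
component larger than θn. Indeed, if F is the generating polynomial of the jumps of size at most L,
the coefficients of exp(Z n F) satisfy the recursion that arises in the graph from removing the
component of one vertex. The prefactor n^m/m! · q^(nm - m²/2) depends on the total m only. Only the
maximum matters here, so it suffices to identify the joint law of total and maximum
(`IsJumpModel.real_total_max`).

After this, a union bound leaves two quantities (`IsJumpModel.exists_bounds`): the probability that
all components are at most εn, and the expected numbers of components of sizes l > εn that are far
from ρn.

The probability is at most exp(-κn), because an exploration with at least γn unexplored vertices,
where γc > 1, dominates a supercritical branching process while it is small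
(`exists_smallProb_le_exp`). This is negligible since a_n² ≪ n.

The expected number of components of size l is at most n/c times the probability that a binomial
variable with n trials and success probability y = 1 - q^l equals l. With x = l/n, y is close to 1 -
exp(-cx), and x - (1 - exp(-cx)) vanishes at ρ with slope 1 - T. If x is at distance δ from ρ, then
l is about (1 - T)δn away from the binomial mean, while the variance is about ρ(1 - ρ)n. Chernoff's
bound gives the exponent nδ²(1 - T)²/(2ρ(1 - ρ)) (`eventually_meanComp_le`), and δ = M a_n/√n yields
the rate. The polynomial factors in n disappear because a_n² ≫ log n. -/

namespace SparseGraph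

/-! ### Exploration of a random graph from a set of roots -/

/-- The probability that `r` vertices are all connected to a set of `s` root vertices, where edges
are absent with probability `q`; the recursion is over the number of neighbours of the roots. -/
noncomputable def reach (q : ℝ) : ℕ → ℕ → ℝ
  | _, 0 => 1
  | s, r + 1 => ∑ j ∈ Finset.range (r + 1), ((r + 1).choose (j + 1) : ℝ) *
      (1 - q ^ s) ^ (j + 1) * q ^ (s * (r - j)) * reach q (j + 1) (r - j)
termination_by _ r => r

theorem reach_zero_right (q : ℝ) (s : ℕ) : reach q s 0 = 1 := by rw [reach]

theorem reach_zero_left (q : ℝ) (r : ℕ) : reach q 0 (r + 1) = 0 := by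
  rw [reach]
  exact Finset.sum_eq_zero fun j _ => by simp

theorem reach_eq_sum (q : ℝ) (s r : ℕ) :
    reach q s r = ∑ j ∈ Finset.range (r + 1), (r.choose j : ℝ) * (1 - q ^ s) ^ j *
      q ^ (s * (r - j)) * reach q j (r - j) := by
  cases r with
  | zero => simp [reach_zero_right]
  | succ r =>
    rw [Finset.sum_range_succ', reach]
    simp [reach_zero_left]

/-- The mean of `φ`, evaluated at the number of vertices connected to `s` roots, among `r`. -/
noncomputable def reachMean (q : ℝ) (φ : ℕ → ℝ) (s r : ℕ) : ℝ :=
  ∑ i ∈ Finset.range (r + 1), (r.choose i : ℝ) * reach q s i * q ^ ((s + i) * (r - i)) * φ i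

/-- Condition on the number j of neighbours of the roots: these become the new roots, and the old
roots have no edges to the other r - j vertices. -/
theorem reachMean_eq_sum (q : ℝ) (φ : ℕ → ℝ) (s r : ℕ) :
    reachMean q φ s r = ∑ j ∈ Finset.range (r + 1), (r.choose j : ℝ) * (1 - q ^ s) ^ j *
      q ^ (s * (r - j)) * reachMean q (fun i => φ (j + i)) j (r - j) := by
  let F : ℕ → ℕ → ℝ := fun j i => (r.choose (j + i) : ℝ) * (((j + i).choose j : ℝ) *
    (1 - q ^ s) ^ j * q ^ (s * i) * reach q j i) * q ^ ((s + (j + i)) * (r - (j + i))) *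
    φ (j + i)
  have h1 : reachMean q φ s r =
      ∑ m ∈ Finset.range (r + 1), ∑ j ∈ Finset.range (m + 1), F j (m - j) := by
    refine Finset.sum_congr rfl fun m _ => ?_
    rw [reach_eq_sum, Finset.mul_sum, Finset.sum_mul, Finset.sum_mul]
    refine Finset.sum_congr rfl fun j hj => ?_
    have hj' : j + (m - j) = m := by have := Finset.mem_range.1 hj; omega
    simp only [F, hj']
  -- The total m of reached vertices is split into j direct neighbours and i = m - j others; summing
  -- over j outside turns the inner sum into a mean over r - j vertices.
  refine h1.trans ((Finset.sum_range_diag_flip (r + 1) F).trans ?_)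
  refine Finset.sum_congr rfl fun j hj => ?_
  have hj' : r + 1 - j = r - j + 1 := by have := Finset.mem_range.1 hj; omega
  rw [hj', reachMean, Finset.mul_sum]
  refine Finset.sum_congr rfl fun i hi => ?_
  obtain ⟨t, rfl⟩ : ∃ t, r = j + i + t :=
    ⟨r - (j + i), by have := Finset.mem_range.1 hi; have := Finset.mem_range.1 hj; omega⟩
  have hc : ((j + i + t).choose (j + i) : ℝ) * ((j + i).choose j : ℝ) =
      ((j + i + t).choose j : ℝ) * ((i + t).choose i : ℝ) := by
    have := Nat.choose_mul (n := j + i + t) (k := j + i) (s := j) (by omega)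
    rw [show j + i + t - j = i + t by omega, show j + i - j = i by omega] at this
    exact_mod_cast this
  have e1 : j + i + t - (j + i) = t := by omega
  have e2 : j + i + t - j = i + t := by omega
  have e3 : i + t - i = t := by omega
  simp only [F, e1, e2, e3]
  have hp : q ^ (s * i) * q ^ ((s + (j + i)) * t) = q ^ (s * (i + t)) * q ^ ((j + i) * t) := by
    rw [← pow_add, ← pow_add]; ring_nf
  linear_combination ((1 - q ^ s) ^ j * reach q j i * φ (j + i)) *
    (q ^ (s * i) * q ^ ((s + (j + i)) * t) * hc +
      ((j + i + t).choose j : ℝ) * ((i + t).choose i : ℝ) * hp)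

theorem reachMean_zero_left (q : ℝ) (φ : ℕ → ℝ) (r : ℕ) : reachMean q φ 0 r = φ 0 := by
  rw [reachMean, Finset.sum_range_succ', Finset.sum_eq_zero]
  · simp [reach_zero_right]
  · intro i _
    simp [reach_zero_left]

theorem sum_binomial (x y : ℝ) (r : ℕ) :
    ∑ j ∈ Finset.range (r + 1), (r.choose j : ℝ) * x ^ j * y ^ (r - j) = (x + y) ^ r := by
  rw [add_pow]
  exact Finset.sum_congr rfl fun j _ => by ring

theorem reachMean_one (q : ℝ) (s r : ℕ) : reachMean q (fun _ => 1) s r = 1 := by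
  induction r using Nat.strong_induction_on generalizing s with
  | _ r ih =>
    -- Without any neighbour (j = 0) the number of remaining vertices does not drop, so the
    -- induction hypothesis is unavailable; the exploration has then stopped.
    have h : ∀ j ∈ Finset.range (r + 1), reachMean q (fun _ => 1) j (r - j) = 1 := by
      intro j hj
      rcases Nat.eq_zero_or_pos j with rfl | hj0
      · exact reachMean_zero_left _ _ _
      · exact ih _ (by have := Finset.mem_range.1 hj; omega) _
    rw [reachMean_eq_sum]
    have := sum_binomial (1 - q ^ s) (q ^ s) r
    rw [sub_add_cancel, one_pow] at this
    refine Eq.trans (Finset.sum_congr rfl fun j hj => ?_) this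
    rw [h j hj, mul_one, pow_mul]

/-- Induction over the generations, closed by the binomial theorem and 1 - q^s + q^s (1 - q^r) = 1 -
q^(s+r). For one root this is the bound on connectivity probabilities behind `meanComp_le`. -/
theorem reach_le {q : ℝ} (hq0 : 0 ≤ q) (hq1 : q ≤ 1) (s r : ℕ) :
    reach q s r ≤ (1 - q ^ (s + r)) ^ r := by
  induction r using Nat.strong_induction_on generalizing s with
  | _ r ih =>
    have h1 : ∀ t, 0 ≤ 1 - q ^ t := fun t => sub_nonneg.2 (pow_le_one₀ hq0 hq1)
    have h : ∀ j ∈ Finset.range (r + 1), reach q j (r - j) ≤ (1 - q ^ r) ^ (r - j) := by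
      intro j hj
      have hj := Finset.mem_range.1 hj
      rcases Nat.eq_zero_or_pos j with rfl | hj0
      · cases r with
        | zero => simp [reach_zero_right]
        | succ r =>
          rw [Nat.sub_zero, reach_zero_left]
          exact pow_nonneg (h1 _) _
      · have := ih (r - j) (by omega) j
        rwa [show j + (r - j) = r by omega] at this
    rw [reach_eq_sum]
    calc _ ≤ ∑ j ∈ Finset.range (r + 1), (r.choose j : ℝ) * (1 - q ^ s) ^ j *
          (q ^ s * (1 - q ^ r)) ^ (r - j) := by
          refine Finset.sum_le_sum fun j hj => ?_
          rw [mul_pow, ← pow_mul, ← mul_assoc]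
          have := h1 s
          exact mul_le_mul_of_nonneg_left (h j hj) (by positivity)
      _ = _ := by
          rw [sum_binomial]
          congr 1
          rw [pow_add]
          ring

/-- Exponential moments of the number of connected vertices, as long as it stays small. -/
theorem reachMean_truncated_le {q z ζ : ℝ} (hq0 : 0 ≤ q) (hq1 : q ≤ 1) (hz : 0 ≤ z) (hζ : 0 ≤ ζ)
    (hzζ : z * ζ ≤ 1) {K₀ R : ℕ}
    (hR : ∀ s ≤ K₀, (1 - (1 - q ^ s) * (1 - z * ζ)) ^ R ≤ ζ ^ s) {K : ℕ} (hK : K ≤ K₀) (s r : ℕ)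
    (hr : R + K ≤ r + s) :
    reachMean q (fun i => if s + i ≤ K then z ^ i else 0) s r ≤ ζ ^ s := by
  induction K using Nat.strong_induction_on generalizing s r with
  | _ K ih =>
    rcases Nat.eq_zero_or_pos s with rfl | hs
    · rw [reachMean_zero_left]
      simp
    have h1 : 0 ≤ 1 - q ^ s := sub_nonneg.2 (pow_le_one₀ hq0 hq1)
    have h1' : 1 - q ^ s ≤ 1 := by have := pow_nonneg hq0 s; linarith
    by_cases hsK : s ≤ K
    swap
    · have : (fun i => if s + i ≤ K then z ^ i else 0) = fun _ => 0 := by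
        funext i
        rw [if_neg (by omega)]
      rw [this]
      simp only [reachMean, mul_zero, Finset.sum_const_zero]
      positivity
    -- The s > 0 old roots are charged to the budget, so the new exploration has budget K - s, while
    -- (r - j) + j = r ≥ R + (K - s) keeps the lower bound on the available vertices.
    have h : ∀ j ∈ Finset.range (r + 1),
        reachMean q (fun i => if s + (j + i) ≤ K then z ^ (j + i) else 0) j (r - j) ≤
          z ^ j * ζ ^ j := by
      intro j hj
      have hj := Finset.mem_range.1 hj
      have e : reachMean q (fun i => if s + (j + i) ≤ K then z ^ (j + i) else 0) j (r - j) =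
          z ^ j * reachMean q (fun i => if j + i ≤ K - s then z ^ i else 0) j (r - j) := by
        simp only [reachMean, Finset.mul_sum]
        refine Finset.sum_congr rfl fun i _ => ?_
        by_cases hi : s + (j + i) ≤ K
        · rw [if_pos hi, if_pos (by omega), pow_add]
          ring
        · rw [if_neg hi, if_neg (by omega)]
          ring
      rw [e]
      exact mul_le_mul_of_nonneg_left (ih (K - s) (by omega) (by omega) _ _ (by omega))
        (by positivity)
    rw [reachMean_eq_sum]
    calc _ ≤ ∑ j ∈ Finset.range (r + 1), (r.choose j : ℝ) * ((1 - q ^ s) * (z * ζ)) ^ j *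
          (q ^ s) ^ (r - j) := by
          refine Finset.sum_le_sum fun j hj => ?_
          calc _ ≤ (r.choose j : ℝ) * (1 - q ^ s) ^ j * q ^ (s * (r - j)) * (z ^ j * ζ ^ j) :=
                mul_le_mul_of_nonneg_left (h j hj) (by positivity)
            _ = _ := by rw [mul_pow, mul_pow, pow_mul]; ring
      _ = (1 - (1 - q ^ s) * (1 - z * ζ)) ^ r := by
          rw [sum_binomial]
          ring
      -- Since s ≤ K, at least R vertices are still unexplored.
      _ ≤ (1 - (1 - q ^ s) * (1 - z * ζ)) ^ R := by
          have h2 : 0 ≤ 1 - z * ζ := by linarith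
          have h3 : 1 - z * ζ ≤ 1 := by have := mul_nonneg hz hζ; linarith
          have h4 : (1 - q ^ s) * (1 - z * ζ) ≤ 1 := mul_le_one₀ h1' h2 h3
          refine pow_le_pow_of_le_one (by linarith) ?_ (by omega)
          have := mul_nonneg h1 h2
          linarith
      _ ≤ ζ ^ s := hR s (hsK.trans hK)

/-! ### Component sizes: recursions, union bound, exponential bounds -/

/-- `P` behaves like the connectivity probabilities of a binomial random graph in which edges are
absent with probability `q`: the sizes of the component of a given vertex sum up to one. -/
def IsConnSeq (q : ℝ) (P : ℕ → ℝ) : Prop :=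
  ∀ m, ∑ k ∈ Finset.range (m + 1), (m.choose k : ℝ) * P (k + 1) * q ^ ((k + 1) * (m - k)) = 1

/-- Both sequences solve the same triangular system, in which the last unknown has coefficient one.
-/
theorem IsConnSeq.eq_reach {q : ℝ} {P : ℕ → ℝ} (hP : IsConnSeq q P) (k : ℕ) :
    P (k + 1) = reach q 1 k := by
  induction k using Nat.strong_induction_on with
  | _ k ih =>
    have h1 := hP k
    have h2 := reachMean_one q 1 k
    rw [reachMean, Finset.sum_range_succ] at h2
    rw [Finset.sum_range_succ] at h1
    have h3 : ∑ i ∈ Finset.range k, (k.choose i : ℝ) * reach q 1 i * q ^ ((1 + i) * (k - i)) * 1 =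
        ∑ i ∈ Finset.range k, (k.choose i : ℝ) * P (i + 1) * q ^ ((i + 1) * (k - i)) := by
      refine Finset.sum_congr rfl fun i hi => ?_
      rw [ih i (Finset.mem_range.1 hi), mul_one, add_comm 1 i]
    rw [h3] at h2
    simp only [Nat.choose_self, Nat.cast_one, Nat.sub_self, mul_zero, pow_zero, mul_one,
      one_mul] at h1 h2
    linarith

/-- The expected number of components of size `l` among `m` vertices. -/
noncomputable def meanComp (q : ℝ) (P : ℕ → ℝ) (m l : ℕ) : ℝ :=
  (m.choose l : ℝ) * P l * q ^ (l * (m - l))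

/-- The probability that all components among `m` vertices have size at most `K`. -/
noncomputable def smallProb (q : ℝ) (P : ℕ → ℝ) (K : ℕ) : ℕ → ℝ
  | 0 => 1
  | m + 1 => ∑ k ∈ Finset.range (m + 1), (if k + 1 ≤ K then
      (m.choose k : ℝ) * P (k + 1) * q ^ ((k + 1) * (m - k)) else 0) * smallProb q P K (m - k)
termination_by m => m

section

variable {q : ℝ} {P : ℕ → ℝ}

theorem smallProb_nonneg (hq : 0 ≤ q) (hP : ∀ k, 0 ≤ P k) (K m : ℕ) : 0 ≤ smallProb q P K m := by
  induction m using Nat.strong_induction_on with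
  | _ m ih =>
    cases m with
    | zero => rw [smallProb]; exact zero_le_one
    | succ m =>
      rw [smallProb]
      refine Finset.sum_nonneg fun k _ => mul_nonneg ?_ (ih _ (by omega))
      have := hP (k + 1)
      split_ifs <;> positivity

theorem smallProb_le_one (hq : 0 ≤ q) (hP : ∀ k, 0 ≤ P k) (hPq : IsConnSeq q P) (K m : ℕ) :
    smallProb q P K m ≤ 1 := by
  induction m using Nat.strong_induction_on with
  | _ m ih =>
    cases m with
    | zero => rw [smallProb]
    | succ m =>
      rw [smallProb, ← hPq m]
      refine Finset.sum_le_sum fun k _ => ?_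
      have h1 := hP (k + 1)
      have h2 := ih (m - k) (by omega)
      split_ifs
      · exact mul_le_of_le_one_right (by positivity) h2
      · rw [zero_mul]; positivity

theorem smallProb_of_le (hPq : IsConnSeq q P) {K m : ℕ} (hm : m ≤ K) : smallProb q P K m = 1 := by
  induction m using Nat.strong_induction_on with
  | _ m ih =>
    cases m with
    | zero => rw [smallProb]
    | succ m =>
      rw [smallProb, ← hPq m]
      refine Finset.sum_congr rfl fun k hk => ?_
      have := Finset.mem_range.1 hk
      rw [if_pos (by omega), ih _ (by omega) (by omega), mul_one]

theorem meanComp_nonneg (hq : 0 ≤ q) (hP : ∀ k, 0 ≤ P k) (m l : ℕ) : 0 ≤ meanComp q P m l := by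
  have := hP l
  rw [meanComp]
  positivity

/-- Distinguish whether the component of the first vertex is the one that is counted. -/
theorem sum_mul_meanComp (hPq : IsConnSeq q P) (m l : ℕ) :
    ∑ k ∈ Finset.range (m + 1), (m.choose k : ℝ) * P (k + 1) * q ^ ((k + 1) * (m - k)) *
      meanComp q P (m - k) (l + 1) + (m.choose l : ℝ) * P (l + 1) * q ^ ((l + 1) * (m - l)) =
    meanComp q P (m + 1) (l + 1) := by
  -- If the counted component avoids the first vertex, choose it first. The component of the first
  -- vertex then lives among the t + 1 remaining vertices, and the probabilities of its sizes sum to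
  -- one.
  have key : ∑ k ∈ Finset.range (m + 1), (m.choose k : ℝ) * P (k + 1) *
      q ^ ((k + 1) * (m - k)) * meanComp q P (m - k) (l + 1) =
      (m.choose (l + 1) : ℝ) * P (l + 1) * q ^ ((l + 1) * (m - l)) := by
    by_cases hl : l + 1 ≤ m
    swap
    · rw [Nat.choose_eq_zero_of_lt (by omega : m < l + 1)]
      simp only [Nat.cast_zero, zero_mul]
      refine Finset.sum_eq_zero fun k _ => ?_
      rw [meanComp, Nat.choose_eq_zero_of_lt (by omega : m - k < l + 1)]
      simp
    obtain ⟨t, rfl⟩ := Nat.exists_eq_add_of_le hl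
    have h2 : Finset.range (t + 1) ⊆ Finset.range (l + 1 + t + 1) := by
      intro x hx
      have := Finset.mem_range.1 hx
      exact Finset.mem_range.2 (by omega)
    rw [← Finset.sum_subset h2]
    · rw [← mul_one ((((l + 1 + t).choose (l + 1) : ℕ) : ℝ) * P (l + 1) *
        q ^ ((l + 1) * (l + 1 + t - l))), ← hPq t, Finset.mul_sum]
      refine Finset.sum_congr rfl fun k hk => ?_
      obtain ⟨u, rfl⟩ : ∃ u, t = k + u := ⟨t - k, by have := Finset.mem_range.1 hk; omega⟩
      have e1 : l + 1 + (k + u) - k = l + 1 + u := by omega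
      have e2 : l + 1 + (k + u) - l = k + u + 1 := by omega
      have e3 : k + u - k = u := by omega
      have e4 : l + 1 + u - (l + 1) = u := by omega
      rw [meanComp, e1, e2, e3, e4]
      have hc : ((l + 1 + (k + u)).choose k : ℝ) * ((l + 1 + u).choose (l + 1) : ℝ) =
          ((l + 1 + (k + u)).choose (l + 1) : ℝ) * ((k + u).choose k : ℝ) := by
        have h1 := Nat.choose_mul (n := l + 1 + (k + u)) (k := l + 1 + k) (s := k) (by omega)
        have h3 := Nat.choose_mul (n := l + 1 + (k + u)) (k := l + 1 + k) (s := l + 1) (by omega)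
        rw [e1, show l + 1 + k - k = l + 1 by omega] at h1
        rw [show l + 1 + (k + u) - (l + 1) = k + u by omega,
          show l + 1 + k - (l + 1) = k by omega,
          Nat.choose_symm_of_eq_add (show l + 1 + k = (l + 1) + k by omega)] at h3
        exact_mod_cast h1.symm.trans h3
      have hp : q ^ ((k + 1) * (l + 1 + u)) * q ^ ((l + 1) * u) =
          q ^ ((l + 1) * (k + u + 1)) * q ^ ((k + 1) * u) := by
        rw [← pow_add, ← pow_add]; ring_nf
      linear_combination (P (k + 1) * P (l + 1)) *
        (q ^ ((k + 1) * (l + 1 + u)) * q ^ ((l + 1) * u) * hc +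
          ((l + 1 + (k + u)).choose (l + 1) : ℝ) * ((k + u).choose k : ℝ) * hp)
    · intro k _ hk
      have := Finset.mem_range.not.1 hk
      rw [meanComp, Nat.choose_eq_zero_of_lt (by omega : l + 1 + t - k < l + 1)]
      simp
  rw [key, meanComp, Nat.choose_succ_succ, show m + 1 - (l + 1) = m - l by omega]
  push_cast
  ring

/-- The union bound over the components of size in `(K, L]`. -/
theorem smallProb_sub_le (hq : 0 ≤ q) (hP : ∀ k, 0 ≤ P k) (hPq : IsConnSeq q P) (K L m : ℕ) :
    smallProb q P L m - smallProb q P K m ≤ ∑ l ∈ Finset.Ioc K L, meanComp q P m l := by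
  induction m using Nat.strong_induction_on with
  | _ m ih =>
    cases m with
    | zero =>
      simp only [smallProb, sub_self]
      exact Finset.sum_nonneg fun l _ => meanComp_nonneg hq hP _ _
    | succ m =>
      set w : ℕ → ℝ := fun k => (m.choose k : ℝ) * P (k + 1) * q ^ ((k + 1) * (m - k)) with hw
      have hw0 : ∀ k, 0 ≤ w k := fun k => by
        have := hP (k + 1)
        simp only [hw]
        positivity
      -- Either the component of the first vertex already has a size in (K, L], which gives the
      -- indicator, or the induction hypothesis applies to the other vertices.
      have hterm : ∀ k ∈ Finset.range (m + 1),
          (if k + 1 ≤ L then w k else 0) * smallProb q P L (m - k) -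
            (if k + 1 ≤ K then w k else 0) * smallProb q P K (m - k) ≤
          w k * ∑ l ∈ Finset.Ioc K L, meanComp q P (m - k) l +
            if k + 1 ∈ Finset.Ioc K L then w k else 0 := by
        intro k _
        have h1 := ih (m - k) (by omega)
        have h2 := smallProb_le_one hq hP hPq L (m - k)
        have h3 := smallProb_nonneg hq hP K (m - k)
        have h4 := smallProb_nonneg hq hP L (m - k)
        have h5 : 0 ≤ ∑ l ∈ Finset.Ioc K L, meanComp q P (m - k) l :=
          Finset.sum_nonneg fun l _ => meanComp_nonneg hq hP _ _
        have h6 := hw0 k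
        have h7 := mul_nonneg h6 h5
        have h8 := mul_le_mul_of_nonneg_left h1 h6
        have h9 := mul_le_mul_of_nonneg_left h2 h6
        have h10 := mul_nonneg h6 h3
        have h11 := mul_nonneg h6 h4
        by_cases hK : k + 1 ≤ K <;> by_cases hL : k + 1 ≤ L
        · rw [if_pos hK, if_pos hL, if_neg (by simp only [Finset.mem_Ioc]; omega)]
          linarith
        · rw [if_pos hK, if_neg hL, if_neg (by simp only [Finset.mem_Ioc]; omega)]
          linarith
        · rw [if_neg hK, if_pos hL, if_pos (by simp only [Finset.mem_Ioc]; omega)]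
          linarith
        · rw [if_neg hK, if_neg hL, if_neg (by simp only [Finset.mem_Ioc]; omega)]
          linarith
      rw [smallProb, smallProb, ← Finset.sum_sub_distrib]
      refine (Finset.sum_le_sum hterm).trans ?_
      simp only [Finset.mul_sum]
      rw [Finset.sum_add_distrib, Finset.sum_comm]
      have hlast : (∑ k ∈ Finset.range (m + 1), if k + 1 ∈ Finset.Ioc K L then w k else 0) ≤
          ∑ l ∈ Finset.Ioc K L, w (l - 1) := by
        rw [← Finset.sum_filter]
        have : ∑ k ∈ Finset.range (m + 1) with k + 1 ∈ Finset.Ioc K L, w k =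
            ∑ l ∈ (Finset.range (m + 1) |>.filter fun k => k + 1 ∈ Finset.Ioc K L).image
              (· + 1), w (l - 1) := by
          rw [Finset.sum_image (by intro a _ b _ h; simpa using h)]
          simp
        rw [this]
        refine Finset.sum_le_sum_of_subset_of_nonneg ?_ fun l _ _ => hw0 _
        intro l hl
        obtain ⟨k, hk, rfl⟩ := Finset.mem_image.1 hl
        exact (Finset.mem_filter.1 hk).2
      refine (add_le_add_right hlast _).trans ?_
      rw [← Finset.sum_add_distrib]
      refine Finset.sum_le_sum fun l hl => ?_
      obtain ⟨l, rfl⟩ : ∃ l', l = l' + 1 :=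
        ⟨l - 1, by have := (Finset.mem_Ioc.1 hl).1; omega⟩
      exact (sum_mul_meanComp hPq m l).le

/-- Components are removed one at a time. Each removal multiplies by the truncated mean of z to the
component size, which is at most one while at least m₀ other vertices are present; the last m₀
vertices cost at most z^m₀. -/
theorem smallProb_le_inv_pow (hq : 0 ≤ q) (hP : ∀ k, 0 ≤ P k) (hPq : IsConnSeq q P)
    {z : ℝ} (hz : 1 ≤ z) {K m₀ : ℕ}
    (h : ∀ m, m₀ ≤ m → ∑ k ∈ Finset.range (m + 1), (if k + 1 ≤ K then
      (m.choose k : ℝ) * P (k + 1) * q ^ ((k + 1) * (m - k)) else 0) * z ^ (k + 1) ≤ 1) (m : ℕ) :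
    smallProb q P K m * z ^ m ≤ z ^ m₀ := by
  have hz0 : 0 ≤ z := zero_le_one.trans hz
  induction m using Nat.strong_induction_on with
  | _ m ih =>
    by_cases hm : m ≤ m₀
    · calc _ ≤ 1 * z ^ m := mul_le_mul_of_nonneg_right (smallProb_le_one hq hP hPq K m)
            (by positivity)
        _ ≤ z ^ m₀ := by rw [one_mul]; exact pow_le_pow_right₀ hz hm
    obtain ⟨m, rfl⟩ : ∃ m', m = m' + 1 := ⟨m - 1, by omega⟩
    rw [smallProb, Finset.sum_mul]
    calc _ ≤ ∑ k ∈ Finset.range (m + 1), (if k + 1 ≤ K then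
          (m.choose k : ℝ) * P (k + 1) * q ^ ((k + 1) * (m - k)) else 0) * z ^ (k + 1) *
            z ^ m₀ := by
          refine Finset.sum_le_sum fun k hk => ?_
          have hk := Finset.mem_range.1 hk
          have e : z ^ (m + 1) = z ^ (k + 1) * z ^ (m - k) := by
            rw [← pow_add]; congr 1; omega
          have h1 := ih (m - k) (by omega)
          have h2 := hP (k + 1)
          rw [e]
          calc _ = (if k + 1 ≤ K then
                (m.choose k : ℝ) * P (k + 1) * q ^ ((k + 1) * (m - k)) else 0) * z ^ (k + 1) *
                  (smallProb q P K (m - k) * z ^ (m - k)) := by ring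
            _ ≤ _ := mul_le_mul_of_nonneg_left h1 (by split_ifs <;> positivity)
      _ ≤ 1 * z ^ m₀ := by
          rw [← Finset.sum_mul]
          exact mul_le_mul_of_nonneg_right (h m (by omega)) (by positivity)
      _ = _ := one_mul _

/-- If the exponential moments of small explorations are bounded, then it is exponentially unlikely that
all components are small. -/
theorem smallProb_le_of_reach (hq0 : 0 ≤ q) (hq1 : q ≤ 1) (hP : ∀ k, 0 ≤ P k)
    (hPq : IsConnSeq q P) {z ζ : ℝ} (hz : 1 ≤ z) (hζ : 0 ≤ ζ) (hzζ : z * ζ ≤ 1) {K R : ℕ}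
    (hR : ∀ s ≤ K, (1 - (1 - q ^ s) * (1 - z * ζ)) ^ R ≤ ζ ^ s) (m : ℕ) :
    smallProb q P K m * z ^ m ≤ z ^ (R + K) := by
  have hz0 : 0 ≤ z := zero_le_one.trans hz
  refine smallProb_le_inv_pow hq0 hP hPq hz (fun m hm => ?_) m
  have h1 := reachMean_truncated_le hq0 hq1 hz0 hζ hzζ hR le_rfl 1 m (by omega)
  calc _ = z * reachMean q (fun i => if 1 + i ≤ K then z ^ i else 0) 1 m := by
        rw [reachMean, Finset.mul_sum]
        refine Finset.sum_congr rfl fun k _ => ?_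
        rw [hPq.eq_reach, add_comm 1 k]
        split_ifs
        · rw [pow_succ]; ring
        · ring
    _ ≤ z * ζ ^ 1 := mul_le_mul_of_nonneg_left h1 hz0
    _ ≤ 1 := by rwa [pow_one]

/-- Chernoff's bound for the expected number of components of a given size. -/
theorem meanComp_le (hq0 : 0 ≤ q) (hq1 : q < 1) (hPq : IsConnSeq q P) (m l : ℕ) (hl : 1 ≤ l)
    (hlm : l ≤ m) (t : ℝ) :
    meanComp q P m l ≤ (1 - q)⁻¹ *
      (Real.exp (-(t * l)) * (1 + (1 - q ^ l) * (Real.exp t - 1)) ^ m) := by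
  obtain ⟨k, rfl⟩ : ∃ k, l = k + 1 := ⟨l - 1, by omega⟩
  set y := 1 - q ^ (k + 1) with hy
  have hy0 : 0 ≤ y := sub_nonneg.2 (pow_le_one₀ hq0 hq1.le)
  have hyq : 1 - q ≤ y := by
    have := pow_le_pow_of_le_one hq0 hq1.le (by omega : 1 ≤ k + 1)
    rw [pow_one] at this
    linarith
  have h1 : P (k + 1) ≤ y ^ k := by
    rw [hPq.eq_reach]
    have := reach_le hq0 hq1.le 1 k
    rwa [add_comm 1 k] at this
  have hpos : 0 < 1 - q := by linarith
  -- The connectivity bound has one factor y too few for a binomial probability; y ≥ 1 - q supplies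
  -- it.
  have h2 : y ^ k ≤ (1 - q)⁻¹ * y ^ (k + 1) := by
    rw [← div_eq_inv_mul, le_div_iff₀ hpos, pow_succ]
    exact mul_le_mul_of_nonneg_left hyq (by positivity)
  -- One term of the binomial expansion of the moment generating function; both signs of t are
  -- allowed.
  have h3 : (m.choose (k + 1) : ℝ) * (y * Real.exp t) ^ (k + 1) * (q ^ (k + 1)) ^ (m - (k + 1)) ≤
      (1 + y * (Real.exp t - 1)) ^ m := by
    have e : 1 + y * (Real.exp t - 1) = y * Real.exp t + q ^ (k + 1) := by rw [hy]; ring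
    rw [e, ← sum_binomial]
    exact Finset.single_le_sum
      (f := fun j => (m.choose j : ℝ) * (y * Real.exp t) ^ j * (q ^ (k + 1)) ^ (m - j))
      (fun j _ => by positivity) (Finset.mem_range.2 (by omega))
  have h4 : Real.exp (-(t * (k + 1 : ℕ))) * Real.exp t ^ (k + 1) = 1 := by
    rw [← Real.exp_nat_mul, ← Real.exp_add]
    simp [mul_comm]
  rw [meanComp]
  calc _ ≤ (m.choose (k + 1) : ℝ) * ((1 - q)⁻¹ * y ^ (k + 1)) * q ^ ((k + 1) * (m - (k + 1))) := by
        gcongr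
        exact h1.trans h2
    _ = (1 - q)⁻¹ * (Real.exp (-(t * (k + 1 : ℕ))) * ((m.choose (k + 1) : ℝ) *
          (y * Real.exp t) ^ (k + 1) * (q ^ (k + 1)) ^ (m - (k + 1)))) := by
        rw [mul_pow, ← pow_mul]
        linear_combination (-((m.choose (k + 1) : ℝ) * ((1 - q)⁻¹ * y ^ (k + 1)) *
          q ^ ((k + 1) * (m - (k + 1))))) * h4
    _ ≤ _ := by gcongr

end

/-! ### The component of a vertex in the binomial random graph -/

section

variable {V W : Type*} [Fintype V] [Fintype W]

/-- The probability of the graph `G` in the binomial model, edges being present with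
probability `p` and absent with probability `q`. -/
noncomputable def graphWeight (p q : ℝ) (G : SimpleGraph V) : ℝ :=
  p ^ G.edgeSet.ncard * q ^ ((Fintype.card V).choose 2 - G.edgeSet.ncard)

theorem ncard_edgeSet_le (G : SimpleGraph V) : G.edgeSet.ncard ≤ (Fintype.card V).choose 2 := by
  classical
  rw [← SimpleGraph.coe_edgeFinset, Set.ncard_coe_finset]
  exact SimpleGraph.card_edgeFinset_le_card_choose_two

theorem binomialRandom_real_eq_sum [Fintype (SimpleGraph V)] (p : unitInterval)
    (A : SimpleGraph V → Prop) [DecidablePred A] :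
    (SimpleGraph.binomialRandom V p).real {G | A G} =
      ∑ G : SimpleGraph V with A G, graphWeight (p : ℝ) (1 - p) G := by
  have h : {G | A G} = ((Finset.univ.filter fun G => A G : Finset (SimpleGraph V)) :
      Set (SimpleGraph V)) := by
    ext; simp
  have : MeasurableSingletonClass (SimpleGraph V) := ⟨fun G => by
    rw [← SimpleGraph.measurableEmbedding_edgeSet.measurableSet_image, Set.image_singleton]
    exact measurableSet_singleton _⟩
  rw [h, ← sum_measureReal_singleton]
  refine Finset.sum_congr rfl fun G _ => ?_
  rw [measureReal_def, SimpleGraph.binomialRandom_singleton, graphWeight]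
  simp

theorem sum_graphWeight [Fintype (SimpleGraph V)] (p : unitInterval) :
    ∑ G : SimpleGraph V, graphWeight (p : ℝ) (1 - p) G = 1 := by
  have := binomialRandom_real_eq_sum (V := V) p fun _ => True
  simpa using this.symm

theorem graphWeight_iso (p q : ℝ) {G : SimpleGraph V} {H : SimpleGraph W} (e : G ≃g H) :
    graphWeight p q G = graphWeight p q H := by
  rw [graphWeight, graphWeight, Fintype.card_congr e.toEquiv,
    ← Nat.card_coe_set_eq, ← Nat.card_coe_set_eq, Nat.card_congr e.mapEdgeSet]

theorem connProb_eq (k : ℕ) (p : unitInterval) (hV : Fintype.card V = k) :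
    connProb k p = (SimpleGraph.binomialRandom V p).real {G | G.Connected} := by
  classical
  rw [connProb, Set.projIcc_val, binomialRandom_real_eq_sum, binomialRandom_real_eq_sum]
  have e : Fin k ≃ V := (Fintype.equivFinOfCardEq hV).symm
  refine Finset.sum_equiv e.simpleGraph (fun G => ?_) fun G _ => ?_
  · simp only [Finset.mem_filter, Finset.mem_univ, true_and]
    exact (SimpleGraph.Iso.comap e.symm G).symm.connected_iff
  · exact graphWeight_iso _ _ (SimpleGraph.Iso.comap e.symm G).symm

/-- The graph that consists of a graph on `S` and a graph on the complement of `S`. -/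
def glue (S : Finset V) (G : SimpleGraph {x // x ∈ S}) (H : SimpleGraph {x // x ∉ S}) :
    SimpleGraph V :=
  G.map (Function.Embedding.subtype _) ⊔ H.map (Function.Embedding.subtype _)

omit [Fintype V] in
theorem glue_adj {S : Finset V} {G : SimpleGraph {x // x ∈ S}} {H : SimpleGraph {x // x ∉ S}}
    {x y : V} : (glue S G H).Adj x y ↔
      (∃ (hx : x ∈ S) (hy : y ∈ S), G.Adj ⟨x, hx⟩ ⟨y, hy⟩) ∨
        ∃ (hx : x ∉ S) (hy : y ∉ S), H.Adj ⟨x, hx⟩ ⟨y, hy⟩ := by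
  simp only [glue, SimpleGraph.sup_adj, SimpleGraph.map_adj, Function.Embedding.subtype_apply,
    Subtype.exists]
  refine or_congr ⟨?_, ?_⟩ ⟨?_, ?_⟩
  · rintro ⟨a, ha, b, hb, h, rfl, rfl⟩
    exact ⟨ha, hb, h⟩
  · rintro ⟨hx, hy, h⟩
    exact ⟨x, hx, y, hy, h, rfl, rfl⟩
  · rintro ⟨a, ha, b, hb, h, rfl, rfl⟩
    exact ⟨ha, hb, h⟩
  · rintro ⟨hx, hy, h⟩
    exact ⟨x, hx, y, hy, h, rfl, rfl⟩

omit [Fintype V] in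
theorem ncard_edgeSet_map {ι : Type*} (f : ι ↪ V) (G : SimpleGraph ι) :
    (G.map f).edgeSet.ncard = G.edgeSet.ncard := by
  rw [SimpleGraph.edgeSet_map]
  exact Set.ncard_image_of_injective _ f.sym2Map.injective

theorem graphWeight_glue [DecidableEq V] (p q : ℝ) (S : Finset V) (G : SimpleGraph {x // x ∈ S})
    (H : SimpleGraph {x // x ∉ S}) :
    graphWeight p q (glue S G H) = graphWeight p q G * graphWeight p q H *
      q ^ (S.card * (Fintype.card V - S.card)) := by
  have hdisj : Disjoint (G.map (Function.Embedding.subtype _)).edgeSet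
      (H.map (Function.Embedding.subtype _)).edgeSet := by
    rw [Set.disjoint_left]
    intro e
    induction e with
    | _ x y =>
      simp only [SimpleGraph.mem_edgeSet, SimpleGraph.map_adj, Function.Embedding.subtype_apply]
      rintro ⟨a, b, -, rfl, -⟩ ⟨a', b', -, h, -⟩
      exact a'.2 (h ▸ a.2)
  have hcard : (glue S G H).edgeSet.ncard = G.edgeSet.ncard + H.edgeSet.ncard := by
    rw [glue, SimpleGraph.edgeSet_sup, Set.ncard_union_eq hdisj (Set.toFinite _) (Set.toFinite _),
      ncard_edgeSet_map, ncard_edgeSet_map]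
  have hG := ncard_edgeSet_le G
  have hH := ncard_edgeSet_le H
  have hSc : Fintype.card {x // x ∉ S} = Fintype.card V - S.card := by
    rw [Fintype.card_subtype_compl, Fintype.card_coe]
  have hS : S.card ≤ Fintype.card V := S.card_le_univ
  rw [graphWeight, graphWeight, graphWeight, hcard]
  rw [hSc] at hH
  rw [Fintype.card_coe] at hG
  rw [hSc, Fintype.card_coe]
  obtain ⟨t, ht⟩ := Nat.exists_eq_add_of_le hS
  rw [ht, Nat.add_sub_cancel_left] at hH ⊢
  have hch : (S.card + t).choose 2 = S.card.choose 2 + t.choose 2 + S.card * t := by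
    rw [Nat.add_choose_eq]
    simp [Finset.Nat.antidiagonal_succ]
    ring
  rw [hch, show S.card.choose 2 + t.choose 2 + S.card * t - (G.edgeSet.ncard + H.edgeSet.ncard) =
    (S.card.choose 2 - G.edgeSet.ncard) + (t.choose 2 - H.edgeSet.ncard) + S.card * t by omega,
    pow_add, pow_add, pow_add]
  ring

omit [Fintype V] in
theorem mem_of_reachable {G : SimpleGraph V} {S : Set V}
    (hS : ∀ x y, G.Adj x y → x ∈ S → y ∈ S) {u v : V} (h : G.Reachable u v) (hu : u ∈ S) :
    v ∈ S := by
  obtain ⟨w⟩ := h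
  induction w with
  | nil => exact hu
  | cons hadj _ ih => exact ih (hS _ _ hadj hu)

/-- Sum of the weights of the graphs in which the component of `v` is `S`. -/
theorem sum_graphWeight_component [DecidableEq V] [Fintype (SimpleGraph V)] (p : unitInterval) (v : V)
    (S : Finset V) (hv : v ∈ S)
    [DecidablePred fun G : SimpleGraph V => (G.connectedComponentMk v).supp = ↑S] :
    ∑ G : SimpleGraph V with (G.connectedComponentMk v).supp = ↑S,
      graphWeight (p : ℝ) (1 - p) G =
        connProb S.card p * (1 - p : ℝ) ^ (S.card * (Fintype.card V - S.card)) := by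
  classical
  have hglue : ∀ G : SimpleGraph V, (∀ x y, G.Adj x y → (x ∈ S ↔ y ∈ S)) →
      glue S (G.comap (Function.Embedding.subtype _))
        (G.comap (Function.Embedding.subtype _)) = G := by
    intro G hG
    ext x y
    rw [glue_adj]
    simp only [SimpleGraph.comap_adj, Function.Embedding.subtype_apply, exists_prop]
    refine ⟨?_, fun h => ?_⟩
    · rintro (⟨_, _, h⟩ | ⟨_, _, h⟩) <;> exact h
    · have := hG x y h
      tauto
  have hclosed : ∀ G : SimpleGraph V, (G.connectedComponentMk v).supp = S →
      ∀ x y, G.Adj x y → (x ∈ S ↔ y ∈ S) := by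
    intro G hG x y hxy
    rw [← Finset.mem_coe, ← Finset.mem_coe, ← hG]
    exact SimpleGraph.ConnectedComponent.mem_supp_congr_adj _ hxy
  -- Cutting along S is a bijection onto pairs of a connected graph on S and an arbitrary graph on
  -- the complement; the weight factorises, with one q for each absent edge across.
  calc _ = ∑ GH ∈ (Finset.univ.filter fun G : SimpleGraph {x // x ∈ S} => G.Connected) ×ˢ
        (Finset.univ : Finset (SimpleGraph {x // x ∉ S})),
          graphWeight (p : ℝ) (1 - p) (glue S GH.1 GH.2) := by
        refine Finset.sum_nbij' (fun G => (G.comap (Function.Embedding.subtype _),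
          G.comap (Function.Embedding.subtype _))) (fun GH => glue S GH.1 GH.2) ?_ ?_ ?_ ?_ ?_
        · intro G hG
          have hG := (Finset.mem_filter.1 hG).2
          refine Finset.mem_product.2 ⟨Finset.mem_filter.2 ⟨Finset.mem_univ _, ?_⟩,
            Finset.mem_univ _⟩
          have h := (G.connectedComponentMk v).connected_toSimpleGraph
          have h2 : (G.induce (G.connectedComponentMk v).supp).Connected := h
          rw [hG] at h2
          exact h2
        · rintro ⟨G, H⟩ hGH
          have hG := (Finset.mem_filter.1 (Finset.mem_product.1 hGH).1).2
          refine Finset.mem_filter.2 ⟨Finset.mem_univ _, ?_⟩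
          ext x
          rw [SimpleGraph.ConnectedComponent.mem_supp_iff, SimpleGraph.ConnectedComponent.eq]
          constructor
          · intro h
            refine mem_of_reachable (S := (S : Set V)) (fun a b hab ha => ?_) h.symm hv
            rcases glue_adj.1 hab with ⟨_, hb, _⟩ | ⟨ha', _⟩
            · exact hb
            · exact absurd ha ha'
          · intro hx
            have h := hG.preconnected ⟨x, hx⟩ ⟨v, hv⟩
            let f : G →g glue S G H :=
              { toFun := fun a => a.1
                map_rel' := fun {a b} hab => glue_adj.2 (Or.inl ⟨a.2, b.2, hab⟩) }
            exact h.map f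
        · intro G hG
          exact hglue G (hclosed G (Finset.mem_filter.1 hG).2)
        · rintro ⟨G, H⟩ _
          refine Prod.ext ?_ ?_
          · ext x y
            simp only [SimpleGraph.comap_adj, Function.Embedding.subtype_apply]
            rw [glue_adj]
            constructor
            · rintro (⟨_, _, h⟩ | ⟨h, _⟩)
              · exact h
              · exact absurd x.2 h
            · intro h
              exact Or.inl ⟨x.2, y.2, h⟩
          · ext x y
            simp only [SimpleGraph.comap_adj, Function.Embedding.subtype_apply]
            rw [glue_adj]
            constructor
            · rintro (⟨h, _⟩ | ⟨_, _, h⟩)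
              · exact absurd h x.2
              · exact h
            · intro h
              exact Or.inr ⟨x.2, y.2, h⟩
        · intro G hG
          rw [hglue G (hclosed G (Finset.mem_filter.1 hG).2)]
    _ = _ := by
        rw [Finset.sum_product]
        simp only [graphWeight_glue]
        have : ∀ G : SimpleGraph {x // x ∈ S}, ∑ H : SimpleGraph {x // x ∉ S},
            graphWeight (p : ℝ) (1 - p) G * graphWeight (p : ℝ) (1 - p) H *
              (1 - p : ℝ) ^ (S.card * (Fintype.card V - S.card)) =
            graphWeight (p : ℝ) (1 - p) G *
              (1 - p : ℝ) ^ (S.card * (Fintype.card V - S.card)) := by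
          intro G
          rw [← Finset.sum_mul, ← Finset.mul_sum, sum_graphWeight, mul_one]
        simp only [this]
        rw [← Finset.sum_mul, ← binomialRandom_real_eq_sum p, connProb_eq _ p (Fintype.card_coe S)]

end

/-- The total weight one is split according to the component of vertex 0. These components are
`insert 0 S` with S among the other m vertices, and their weights depend on the cardinality of S
only. -/
theorem isConnSeq_connProb (p : unitInterval) : IsConnSeq (1 - p) fun k => connProb k p := by
  classical
  intro m
  set V := Fin (m + 1)
  have h1 := sum_graphWeight (V := V) p
  have h2 : ∀ G : SimpleGraph V, G ∈ (Finset.univ : Finset (SimpleGraph V)) →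
      (G.connectedComponentMk 0).supp.toFinset ∈
        ((Finset.univ.erase (0 : V)).powerset.image (insert (0 : V))) := by
    intro G _
    refine Finset.mem_image.2 ⟨(G.connectedComponentMk 0).supp.toFinset.erase 0, ?_, ?_⟩
    · exact Finset.mem_powerset.2 (Finset.erase_subset_erase _ (Finset.subset_univ _))
    · refine Finset.insert_erase ?_
      simp
  rw [← Finset.sum_fiberwise_of_maps_to h2, Finset.sum_image] at h1
  swap
  · intro a ha b hb hab
    have ha := Finset.mem_powerset.1 (Finset.mem_coe.1 ha)
    have hb := Finset.mem_powerset.1 (Finset.mem_coe.1 hb)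
    have ha0 : (0 : V) ∉ a := fun h => by simpa using ha h
    have hb0 : (0 : V) ∉ b := fun h => by simpa using hb h
    rw [← Finset.erase_insert ha0, ← Finset.erase_insert hb0]
    exact congrArg (fun s => Finset.erase s (0 : V)) hab
  refine Eq.trans ?_ h1
  have h3 : ∀ S ∈ (Finset.univ.erase (0 : V)).powerset,
      ∑ G : SimpleGraph V with (G.connectedComponentMk 0).supp.toFinset = insert 0 S,
        graphWeight (p : ℝ) (1 - p) G =
      connProb (S.card + 1) p * (1 - p : ℝ) ^ ((S.card + 1) * (m - S.card)) := by
    intro S hS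
    have hS0 : (0 : V) ∉ S := fun h => by simpa using Finset.mem_powerset.1 hS h
    have h4 := sum_graphWeight_component p (0 : V) (insert 0 S) (Finset.mem_insert_self _ _)
    have hc : (insert (0 : V) S).card = S.card + 1 := Finset.card_insert_of_notMem hS0
    rw [hc, Fintype.card_fin, Nat.add_sub_add_right] at h4
    rw [← h4]
    refine Finset.sum_congr ?_ fun _ _ => rfl
    ext G
    simp only [Finset.mem_filter, Finset.mem_univ, true_and]
    rw [← Finset.coe_inj, Set.coe_toFinset]
  rw [Finset.sum_congr rfl h3, Finset.sum_powerset_apply_card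
    (fun k => connProb (k + 1) p * (1 - p : ℝ) ^ ((k + 1) * (m - k)))]
  rw [Finset.card_erase_of_mem (Finset.mem_univ _), Finset.card_univ, Fintype.card_fin,
    Nat.add_sub_cancel]
  refine Finset.sum_congr rfl fun k _ => ?_
  rw [nsmul_eq_mul]
  ring

theorem connProb_nonneg (k : ℕ) (p : ℝ) : 0 ≤ connProb k p := measureReal_nonneg

/-! ### Generating functions and the compound Poisson law -/

/-- The coefficients of the exponential of a polynomial are determined by a recursion. -/
theorem sum_pow_div_factorial_coeff (F : Polynomial ℝ) (hF : F.coeff 0 = 0) (lam : ℝ) (h : ℕ → ℝ)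
    (h0 : h 0 = 1)
    (hrec : ∀ m : ℕ, (m + 1 : ℝ) * h (m + 1) =
      ∑ k ∈ Finset.range (m + 1), (k + 1 : ℝ) * (lam * F.coeff (k + 1)) * h (m - k))
    (m M : ℕ) (hm : m ≤ M) :
    ∑ j ∈ Finset.range (M + 1), lam ^ j / (j.factorial : ℝ) * (F ^ j).coeff m = h m := by
  induction m using Nat.strong_induction_on generalizing M with
  | _ m ih =>
    cases m with
    | zero =>
      rw [Finset.sum_range_succ', Finset.sum_eq_zero]
      · simp [h0]
      · intro j _
        simp [Polynomial.coeff_zero_eq_eval_zero, ← Polynomial.coeff_zero_eq_eval_zero F, hF]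
    | succ m =>
      have hm1 : (m + 1 : ℝ) ≠ 0 := by positivity
      refine mul_left_cancel₀ hm1 ?_
      rw [hrec]
      obtain ⟨M, rfl⟩ : ∃ M', M = M' + 1 := ⟨M - 1, by omega⟩
      -- Coefficient of X^m in (F^(j+1))' = (j+1) F^j F'; summed over j, this is H' = lam F' H for H
      -- = exp(lam F).
      have hder : ∀ j, (m + 1 : ℝ) * (lam ^ (j + 1) / ((j + 1).factorial : ℝ) *
          (F ^ (j + 1)).coeff (m + 1)) =
          ∑ k ∈ Finset.range (m + 1), (k + 1 : ℝ) * (lam * F.coeff (k + 1)) *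
            (lam ^ j / (j.factorial : ℝ) * (F ^ j).coeff (m - k)) := by
        intro j
        have h1 : (Polynomial.derivative (F ^ (j + 1))).coeff m =
            (F ^ (j + 1)).coeff (m + 1) * (m + 1) := Polynomial.coeff_derivative _ _
        rw [Polynomial.derivative_pow_succ, mul_assoc, mul_comm (F ^ j),
          Polynomial.coeff_C_mul, Polynomial.coeff_mul,
          Finset.Nat.sum_antidiagonal_eq_sum_range_succ_mk] at h1
        simp only [Polynomial.coeff_derivative] at h1
        rw [Nat.factorial_succ]
        have hj : ((j + 1 : ℕ) : ℝ) ≠ 0 := by positivity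
        have hj' : (j.factorial : ℝ) ≠ 0 := by positivity
        calc _ = lam ^ (j + 1) / (((j + 1) * j.factorial : ℕ) : ℝ) *
              ((F ^ (j + 1)).coeff (m + 1) * (m + 1)) := by ring
          _ = _ := by
            rw [← h1, Finset.mul_sum, Finset.mul_sum]
            refine Finset.sum_congr rfl fun k _ => ?_
            push_cast at hj ⊢
            field_simp
            ring
      rw [Finset.sum_range_succ', mul_add, Finset.mul_sum]
      simp only [hder]
      rw [Finset.sum_comm]
      simp only [pow_zero, Nat.factorial_zero, Nat.cast_one, div_one,
        Polynomial.coeff_one, Nat.succ_ne_zero, if_false, mul_zero, add_zero]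
      -- Splitting off the power zero has lowered the cutoff by one; it still covers every index m -
      -- k.
      refine Finset.sum_congr rfl fun k hk => ?_
      rw [← Finset.mul_sum, ih (m - k) (by omega) M (by omega)]

/-- The polynomial whose coefficients are the probabilities of jumps of size at most `L`. -/
noncomputable def jumpPoly (c θ : ℝ) (n L : ℕ) : Polynomial ℝ :=
  ∑ k ∈ jumpSizes θ n with k ≤ L, Polynomial.monomial k (jumpWeight c n k / partitionZ c θ n)

theorem coeff_jumpPoly (c θ : ℝ) (n L k : ℕ) : (jumpPoly c θ n L).coeff k =
    if k ∈ jumpSizes θ n ∧ k ≤ L then jumpWeight c n k / partitionZ c θ n else 0 := by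
  rw [jumpPoly, Polynomial.finsetSum_coeff]
  simp only [Polynomial.coeff_monomial]
  rw [Finset.sum_ite_eq']
  simp

theorem coeff_jumpPoly_zero (c θ : ℝ) (n L : ℕ) : (jumpPoly c θ n L).coeff 0 = 0 := by
  rw [coeff_jumpPoly, if_neg]
  simp [jumpSizes]

theorem coeff_jumpPoly_pow (c θ : ℝ) (n L : ℕ) {j m : ℕ} (hmj : m < j) :
    ((jumpPoly c θ n L) ^ j).coeff m = 0 := by
  obtain ⟨G, hG⟩ := Polynomial.X_dvd_iff.2 (coeff_jumpPoly_zero c θ n L)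
  rw [hG, mul_pow, Polynomial.coeff_X_pow_mul', if_neg (by omega)]

theorem jumpWeight_nonneg {c : ℝ} {n : ℕ} (hcn : c / n ≤ 1) (k : ℕ) : 0 ≤ jumpWeight c n k := by
  have h1 := connProb_nonneg k (c / n)
  have h2 : 0 ≤ 1 - c / n := by linarith
  rw [jumpWeight]
  positivity

section

variable {c θ : ℝ} {n : ℕ} {Ω : Type*} [MeasurableSpace Ω] {μ : Measure Ω}
  {N : Ω → ℕ} {X : ℕ → Ω → ℕ}

theorem IsJumpModel.partitionZ_pos [IsProbabilityMeasure μ] (h : IsJumpModel c θ n μ N X)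
    (hcn : c / n ≤ 1) : 0 < partitionZ c θ n := by
  have h0 : 0 ≤ partitionZ c θ n := Finset.sum_nonneg fun k _ => jumpWeight_nonneg hcn k
  refine h0.lt_of_ne fun hZ => ?_
  have h1 := Measure.isProbabilityMeasure_map (h.measurable_jump 0).aemeasurable (μ := μ)
  have h2 : jumpLaw c θ n = 0 := by
    rw [jumpLaw, ← hZ]
    simp
  rw [h.map_jump, h2] at h1
  exact IsProbabilityMeasure.ne_zero (0 : Measure ℕ) rfl

theorem jumpLaw_real_singleton (hcn : c / n ≤ 1) (k : ℕ) : (jumpLaw c θ n).real {k} =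
    if k ∈ jumpSizes θ n then jumpWeight c n k / partitionZ c θ n else 0 := by
  have h0 : 0 ≤ partitionZ c θ n := Finset.sum_nonneg fun k _ => jumpWeight_nonneg hcn k
  have h1 : jumpLaw c θ n {k} = if k ∈ jumpSizes θ n then
      ENNReal.ofReal (jumpWeight c n k / partitionZ c θ n) else 0 := by
    rw [jumpLaw, Measure.finsetSum_apply]
    simp only [Measure.smul_apply, MeasurableSet.singleton, Measure.dirac_apply', smul_eq_mul,
      Set.indicator_apply, Set.mem_singleton_iff, Pi.one_apply, mul_ite, mul_one, mul_zero]
    rw [Finset.sum_ite_eq']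
  rw [measureReal_def, h1]
  split_ifs
  · exact ENNReal.toReal_ofReal (div_nonneg (jumpWeight_nonneg hcn k) h0)
  · rfl

/-- The law of the sum of `j` jumps, restricted to jumps of size at most `L`. -/
theorem IsJumpModel.real_sum_eq [IsProbabilityMeasure μ] (h : IsJumpModel c θ n μ N X)
    (hcn : c / n ≤ 1) (L j m : ℕ) :
    μ.real {ω | ∑ i ∈ Finset.range j, X i ω = m ∧ ∀ i ∈ Finset.range j, X i ω ≤ L} =
      ((jumpPoly c θ n L) ^ j).coeff m := by
  induction j generalizing m with
  | zero =>
    rw [pow_zero, Polynomial.coeff_one]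
    by_cases hm : m = 0
    · simp [hm]
    · simp [hm, Ne.symm hm]
  | succ j ih =>
    have hXm := h.measurable_jump
    rw [pow_succ, Polynomial.coeff_mul]
    -- The last jump is split off; independence then turns the convolution into a product of
    -- polynomials.
    have hset : {ω | ∑ i ∈ Finset.range (j + 1), X i ω = m ∧
        ∀ i ∈ Finset.range (j + 1), X i ω ≤ L} =
        ⋃ ab ∈ Finset.HasAntidiagonal.antidiagonal m,
          {ω | ∑ i ∈ Finset.range j, X i ω = ab.1 ∧ ∀ i ∈ Finset.range j, X i ω ≤ L} ∩
            {ω | X j ω = ab.2 ∧ ab.2 ≤ L} := by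
      ext ω
      simp only [Set.mem_iUnion, Set.mem_inter_iff, Set.mem_ofPred_eq, Finset.HasAntidiagonal.mem_antidiagonal,
        Finset.sum_range_succ, exists_prop, Prod.exists]
      constructor
      · rintro ⟨h1, h2⟩
        exact ⟨_, _, h1, ⟨rfl, fun i hi => h2 i (Finset.mem_range.2
          (by have := Finset.mem_range.1 hi; omega))⟩, rfl, h2 j (by simp)⟩
      · rintro ⟨a, b, hab, ⟨h1, h2⟩, h3, h4⟩
        refine ⟨by rw [h1, h3, hab], fun i hi => ?_⟩
        rcases Nat.lt_succ_iff_lt_or_eq.1 (Finset.mem_range.1 hi) with hi | rfl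
        · exact h2 i (Finset.mem_range.2 hi)
        · exact h3 ▸ h4
    have hmeas1 : ∀ a, MeasurableSet
        {ω | ∑ i ∈ Finset.range j, X i ω = a ∧ ∀ i ∈ Finset.range j, X i ω ≤ L} := by
      intro a
      have h1 : MeasurableSet {ω | ∑ i ∈ Finset.range j, X i ω = a} :=
        measurableSet_eq_fun (Finset.measurable_fun_sum _ fun i _ => hXm i) measurable_const
      have h2 : MeasurableSet (⋂ i ∈ Finset.range j, {ω | X i ω ≤ L}) :=
        Finset.measurableSet_biInter _ fun i _ => measurableSet_le (hXm i) measurable_const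
      convert h1.inter h2 using 1
      ext; simp
    have hmeas2 : ∀ b, MeasurableSet {ω | X j ω = b ∧ b ≤ L} := fun b =>
      (measurableSet_eq_fun (hXm j) measurable_const).inter (MeasurableSet.const _)
    rw [hset, measureReal_biUnion_finset]
    · refine Finset.sum_congr rfl fun ab _ => ?_
      have hind := h.indep_jumps.indepFun_finset (Finset.range j) {j} (by simp) hXm
      have h1 := hind.measure_inter_preimage_eq_mul
        {f : Finset.range j → ℕ | ∑ i, f i = ab.1 ∧ ∀ i, f i ≤ L}
        {f : ({j} : Finset ℕ) → ℕ | f ⟨j, by simp⟩ = ab.2 ∧ ab.2 ≤ L}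
        (Set.to_countable _).measurableSet (Set.to_countable _).measurableSet
      have e1 : (fun ω (i : Finset.range j) => X i ω) ⁻¹'
          {f : Finset.range j → ℕ | ∑ i, f i = ab.1 ∧ ∀ i, f i ≤ L} =
          {ω | ∑ i ∈ Finset.range j, X i ω = ab.1 ∧ ∀ i ∈ Finset.range j, X i ω ≤ L} := by
        ext ω
        simp only [Set.mem_preimage, Set.mem_ofPred_eq, Subtype.forall]
        rw [Finset.sum_coe_sort (Finset.range j) fun i => X i ω]
      rw [e1] at h1
      have h2 : μ.real {ω | X j ω = ab.2 ∧ ab.2 ≤ L} = (jumpPoly c θ n L).coeff ab.2 := by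
        rw [coeff_jumpPoly]
        by_cases hL : ab.2 ≤ L
        · have h3 := jumpLaw_real_singleton (θ := θ) hcn ab.2
          rw [← h.map_jump j, measureReal_def,
            Measure.map_apply (hXm j) (measurableSet_singleton _)] at h3
          simp only [hL, and_true]
          exact h3
        · simp [hL]
      rw [← ih, ← h2, measureReal_def, measureReal_def, measureReal_def, ← ENNReal.toReal_mul]
      exact congrArg ENNReal.toReal h1
    · intro ab _ cd _ hne
      refine Set.disjoint_left.2 fun ω h1 h2 => hne ?_
      exact Prod.ext (h1.1.1.symm.trans h2.1.1) (h1.2.1.symm.trans h2.2.1)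
    · exact fun ab _ => (hmeas1 _).inter (hmeas2 _)

theorem IsJumpModel.measurableSet_total_max (h : IsJumpModel c θ n μ N X) (m : ℕ) (A : Set ℕ) :
    MeasurableSet {ω | totalJump N X ω = m ∧ maxJump N X ω ∈ A} := by
  have : {ω | totalJump N X ω = m ∧ maxJump N X ω ∈ A} = ⋃ j, (N ⁻¹' {j} ∩
      (fun ω (i : Finset.range j) => X i ω) ⁻¹'
        {f | ∑ i, f i = m ∧ (Finset.univ.sup f) ∈ A}) := by
    ext ω
    simp only [totalJump, maxJump, Set.mem_ofPred_eq, Set.mem_iUnion, Set.mem_inter_iff,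
      Set.mem_preimage, Set.mem_singleton_iff]
    rw [exists_eq_left']
    rw [Finset.sum_coe_sort (Finset.range (N ω)) fun i => X i ω,
      ← Finset.sup_attach (Finset.range (N ω)) fun i => X i ω]
    rfl
  rw [this]
  refine MeasurableSet.iUnion fun j => ?_
  refine (h.measurable_count (measurableSet_singleton j)).inter ?_
  have hj : Measurable fun ω (i : Finset.range j) => X i ω :=
    measurable_pi_lambda _ fun i => h.measurable_jump i
  exact hj (Set.to_countable _).measurableSet

theorem IsJumpModel.real_total_eq_sum [IsProbabilityMeasure μ] (h : IsJumpModel c θ n μ N X)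
    (hcn : c / n ≤ 1) (L m : ℕ) :
    μ.real {ω | totalJump N X ω = m ∧ maxJump N X ω ≤ L} =
      Real.exp (-(partitionZ c θ n * n)) * ∑ j ∈ Finset.range (m + 1),
        (partitionZ c θ n * n) ^ j / (j.factorial : ℝ) * ((jumpPoly c θ n L) ^ j).coeff m := by
  set lam := partitionZ c θ n * n with hlam
  have hlam0 : 0 ≤ lam := by
    have := h.partitionZ_pos hcn
    positivity
  set B : ℕ → Set Ω := fun j =>
    {ω | ∑ i ∈ Finset.range j, X i ω = m ∧ ∀ i ∈ Finset.range j, X i ω ≤ L} with hB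
  have hBj : ∀ j, μ.real (N ⁻¹' {j} ∩ B j) =
      Real.exp (-lam) * (lam ^ j / (j.factorial : ℝ) * ((jumpPoly c θ n L) ^ j).coeff m) := by
    intro j
    have hmT : MeasurableSet
        {f : ℕ → ℕ | ∑ i ∈ Finset.range j, f i = m ∧ ∀ i ∈ Finset.range j, f i ≤ L} := by
      have h1 : MeasurableSet {f : ℕ → ℕ | ∑ i ∈ Finset.range j, f i = m} :=
        measurableSet_eq_fun
          (Finset.measurable_fun_sum _ fun i _ => measurable_pi_apply i) measurable_const
      have h2 : MeasurableSet (⋂ i ∈ Finset.range j, {f : ℕ → ℕ | f i ≤ L}) :=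
        Finset.measurableSet_biInter _ fun i _ =>
          measurableSet_le (measurable_pi_apply i) measurable_const
      convert h1.inter h2 using 1
      ext; simp
    have h1 := h.indep_count.measure_inter_preimage_eq_mul {j} _ (measurableSet_singleton j) hmT
    have h2 : μ.real (N ⁻¹' {j}) = Real.exp (-lam) * lam ^ j / (j.factorial : ℝ) := by
      have := poissonMeasure_real_singleton lam.toNNReal j
      rw [← h.map_count, measureReal_def,
        Measure.map_apply h.measurable_count (measurableSet_singleton _),
        Real.coe_toNNReal _ hlam0] at this
      exact this
    have h3 := h.real_sum_eq hcn L j m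
    have h4 : μ.real (N ⁻¹' {j} ∩ B j) = μ.real (N ⁻¹' {j}) * μ.real (B j) := by
      rw [measureReal_def, measureReal_def, measureReal_def, ← ENNReal.toReal_mul]
      exact congrArg ENNReal.toReal h1
    rw [h4, h2, h3]
    ring
  have hmeas : ∀ j, MeasurableSet (N ⁻¹' {j} ∩ B j) := by
    intro j
    have : N ⁻¹' {j} ∩ B j = N ⁻¹' {j} ∩
        {ω | totalJump N X ω = m ∧ maxJump N X ω ∈ Set.Iic L} := by
      ext ω
      simp only [hB, Set.mem_inter_iff, Set.mem_preimage, Set.mem_singleton_iff,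
        Set.mem_ofPred_eq, Set.mem_Iic, totalJump, maxJump, Finset.sup_le_iff]
      refine and_congr_right fun hN => ?_
      rw [hN]
    rw [this]
    exact (h.measurable_count (measurableSet_singleton j)).inter
      (h.measurableSet_total_max m (Set.Iic L))
  have hset : {ω | totalJump N X ω = m ∧ maxJump N X ω ≤ L} = ⋃ j, (N ⁻¹' {j} ∩ B j) := by
    ext ω
    simp only [totalJump, maxJump, Set.mem_ofPred_eq, Set.mem_iUnion, Set.mem_inter_iff,
      Set.mem_preimage, Set.mem_singleton_iff, hB, exists_eq_left', Finset.sup_le_iff]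
  -- Jumps are at least one, so more than m of them almost surely do not sum to m.
  have hzero : ∀ j ∉ Finset.range (m + 1), μ (N ⁻¹' {j} ∩ B j) = 0 := by
    intro j hj
    have := hBj j
    rw [coeff_jumpPoly_pow c θ n L (by have := Finset.mem_range.not.1 hj; omega), mul_zero,
      mul_zero, measureReal_eq_zero_iff] at this
    exact this
  rw [measureReal_def, hset, measure_iUnion _ hmeas, tsum_eq_sum hzero,
    ENNReal.toReal_sum (fun _ _ => measure_ne_top _ _), Finset.mul_sum]
  · exact Finset.sum_congr rfl fun j _ => hBj j
  · intro i j hij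
    refine Set.disjoint_left.2 fun ω h1 h2 => hij ?_
    exact h1.1.symm.trans h2.1

/-- The compound Poisson process is the process of component sizes of a binomial random graph. -/
theorem IsJumpModel.real_total_max [IsProbabilityMeasure μ] (h : IsJumpModel c θ n μ N X)
    (hc : 0 < c) (hcn : c < n) (L m : ℕ) :
    μ.real {ω | totalJump N X ω = m ∧ maxJump N X ω ≤ L} =
      Real.exp (-(partitionZ c θ n * n)) * ((n : ℝ) ^ m / (m.factorial : ℝ) *
        (1 - c / n) ^ ((n : ℝ) * m - (m : ℝ) ^ 2 / 2)) *
          smallProb (1 - c / n) (fun k => connProb k (c / n)) (min L ⌊θ * n⌋₊) m := by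
  have hn : (0 : ℝ) < n := hc.trans hcn
  have hcn1 : c / n < 1 := (div_lt_one hn).2 hcn
  have hZ := h.partitionZ_pos hcn1.le
  rw [h.real_total_eq_sum hcn1.le, mul_assoc]
  congr 1
  set q := 1 - c / n with hq
  have hq0 : 0 < q := by linarith
  set K := min L ⌊θ * n⌋₊ with hK
  refine sum_pow_div_factorial_coeff _ (coeff_jumpPoly_zero c θ n L) _
    (fun m => (n : ℝ) ^ m / (m.factorial : ℝ) * q ^ ((n : ℝ) * m - (m : ℝ) ^ 2 / 2) *
      smallProb q (fun k => connProb k (c / n)) K m) ?_ (fun m => ?_) m m le_rfl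
  · simp [smallProb]
  · rw [smallProb, Finset.mul_sum, Finset.mul_sum]
    refine Finset.sum_congr rfl fun k hk => ?_
    obtain ⟨t, rfl⟩ := Nat.exists_eq_add_of_le (Nat.lt_succ_iff.1 (Finset.mem_range.1 hk))
    rw [Nat.add_sub_cancel_left, coeff_jumpPoly]
    have hiff : (k + 1 ∈ jumpSizes θ n ∧ k + 1 ≤ L) ↔ k + 1 ≤ K := by
      rw [hK, jumpSizes, Finset.mem_Icc, le_min_iff]
      constructor
      · exact fun h => ⟨h.2, h.1.2⟩
      · exact fun h => ⟨⟨by omega, h.2⟩, h.1⟩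
    simp only [hiff]
    split_ifs
    swap
    · simp
    -- The exponent nm - m²/2 is additive up to the product of the two sizes, which is matched by
    -- the absent edges between a component of size k + 1 and t other vertices, up to the (k + 1)t
    -- edges counted here.
    have hpow : q ^ ((n : ℝ) * ((k + t + 1 : ℕ) : ℝ) - ((k + t + 1 : ℕ) : ℝ) ^ 2 / 2) *
        q ^ ((k + 1) * t) =
        q ^ ((n : ℝ) * ((k + 1 : ℕ) : ℝ) - ((k + 1 : ℕ) : ℝ) ^ 2 / 2) *
          q ^ ((n : ℝ) * (t : ℝ) - (t : ℝ) ^ 2 / 2) := by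
      rw [← Real.rpow_natCast q ((k + 1) * t), ← Real.rpow_add hq0, ← Real.rpow_add hq0]
      congr 1
      push_cast
      ring
    have hch : ((k + t).choose k : ℝ) * (k.factorial : ℝ) * (t.factorial : ℝ) =
        ((k + t).factorial : ℝ) := by
      have := Nat.choose_mul_factorial_mul_factorial (Nat.le_add_right k t)
      rw [Nat.add_sub_cancel_left] at this
      exact_mod_cast this
    -- The normalisation of the jump law cancels against the mean of the Poisson variable.
    have h1 : partitionZ c θ n * n * (jumpWeight c n (k + 1) / partitionZ c θ n) =
        n * jumpWeight c n (k + 1) := by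
      field_simp
    rw [h1, jumpWeight, Nat.add_sub_cancel, ← hq, Nat.factorial_succ (k + t), Nat.factorial_succ k]
    have hk0 : (k.factorial : ℝ) ≠ 0 := by positivity
    have ht0 : (t.factorial : ℝ) ≠ 0 := by positivity
    have hkt0 : ((k + t).factorial : ℝ) ≠ 0 := by positivity
    have hk1 : ((k : ℝ) + 1) ≠ 0 := by positivity
    have hkt1 : (((k + t : ℕ) : ℝ) + 1) ≠ 0 := by positivity
    set Q1 := q ^ ((n : ℝ) * ((k + t + 1 : ℕ) : ℝ) - ((k + t + 1 : ℕ) : ℝ) ^ 2 / 2)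
    set Q2 := q ^ ((n : ℝ) * ((k + 1 : ℕ) : ℝ) - ((k + 1 : ℕ) : ℝ) ^ 2 / 2)
    set Q3 := q ^ ((n : ℝ) * (t : ℝ) - (t : ℝ) ^ 2 / 2)
    set Q4 := q ^ ((k + 1) * t)
    set C := smallProb q (fun k => connProb k (c / n)) K t
    set D := connProb (k + 1) (c / n)
    calc _ = (n : ℝ) ^ (k + t + 1) * C * D * (Q1 * Q4) *
          (((k + t).choose k : ℝ) / ((k + t).factorial : ℝ)) := by
          push_cast at hkt1 ⊢
          field_simp
      _ = (n : ℝ) ^ (k + t + 1) * C * D * (Q2 * Q3) *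
          (1 / ((k.factorial : ℝ) * (t.factorial : ℝ))) := by
          rw [hpow, ← hch]
          have : ((k + t).choose k : ℝ) ≠ 0 := by
            have := Nat.choose_pos (Nat.le_add_right k t)
            positivity
          field_simp
      _ = _ := by
          push_cast
          field_simp
          ring

end

/-! ### A component of linear size exists -/

theorem one_sub_pow_ge {u : ℝ} (hu1 : u ≤ 1) (s : ℕ) (hs : 0 ≤ u * s) :
    u * s * (1 - u * s / 2) ≤ 1 - (1 - u) ^ s := by
  have h1 : (1 - u) ^ s ≤ Real.exp (-(u * s)) := by
    calc (1 - u) ^ s ≤ Real.exp (-u) ^ s :=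
          pow_le_pow_left₀ (by linarith) (Real.one_sub_le_exp_neg u) s
      _ = _ := by rw [← Real.exp_nat_mul]; ring_nf
  have h2 : Real.exp (-(u * s)) ≤ 1 - u * s + (u * s) ^ 2 / 2 := by
    set v := u * s
    have h3 := Real.quadratic_le_exp_of_nonneg hs
    have h4 : Real.exp (-v) * Real.exp v = 1 := by rw [← Real.exp_add]; simp
    have h5 : (0 : ℝ) ≤ 1 - v + v ^ 2 / 2 := by nlinarith [sq_nonneg (v - 1)]
    -- The product equals 1 + v⁴/4.
    have h6 : (1 : ℝ) ≤ (1 - v + v ^ 2 / 2) * (1 + v + v ^ 2 / 2) := by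
      nlinarith [sq_nonneg (v ^ 2)]
    have h7 : (1 : ℝ) ≤ (1 - v + v ^ 2 / 2) * Real.exp v :=
      h6.trans (mul_le_mul_of_nonneg_left h3 h5)
    exact le_of_mul_le_mul_right (by rwa [h4]) (Real.exp_pos v)
  nlinarith

/-- In the supercritical regime it is exponentially unlikely that all components are smaller
than a small multiple of the number of vertices. -/
theorem exists_smallProb_le_exp {c : ℝ} (hc : 1 < c) {ε₀ : ℝ} (hε₀ : 0 < ε₀) :
    ∃ ε > 0, ε < ε₀ ∧ ∃ κ > 0, ∀ᶠ n : ℕ in atTop, ∀ P : ℕ → ℝ, (∀ k, 0 ≤ P k) →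
      IsConnSeq (1 - c / n) P → smallProb (1 - c / n) P ⌊ε * n⌋₊ n ≤ Real.exp (-(κ * n)) := by
  have hc0 : 0 < c := by linarith
  -- The midpoint of 1/c and 1: an exploration with γn unexplored vertices is still supercritical.
  set γ : ℝ := (1 + 1 / c) / 2 with hγ
  have hγc : γ * c = (c + 1) / 2 := by rw [hγ]; field_simp
  have hγ1 : γ < 1 := by
    rw [hγ]
    have := (div_lt_one hc0).2 hc
    linarith
  have hγ0 : 0 < γ := by positivity
  obtain ⟨ε, hε0, hεε₀, hεγ, hεc⟩ : ∃ ε > 0, ε < ε₀ ∧ ε < (1 - γ) / 2 ∧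
      1 < γ * c * (1 - c * ε / 2) := by
    have h1 : ∀ᶠ ε in 𝓝[>] (0 : ℝ), ε < ε₀ := nhdsWithin_le_nhds (gt_mem_nhds hε₀)
    have h2 : ∀ᶠ ε in 𝓝[>] (0 : ℝ), ε < (1 - γ) / 2 :=
      nhdsWithin_le_nhds (gt_mem_nhds (by linarith))
    have h3 : ∀ᶠ ε in 𝓝[>] (0 : ℝ), 1 < γ * c * (1 - c * ε / 2) := by
      refine nhdsWithin_le_nhds ?_
      have h4 : ContinuousAt (fun ε : ℝ => γ * c * (1 - c * ε / 2)) 0 := by fun_prop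
      refine h4.eventually (lt_mem_nhds ?_)
      rw [hγc]
      linarith
    obtain ⟨ε, h, h1, h2, h3⟩ := (eventually_mem_nhdsWithin.and (h1.and (h2.and h3))).exists
    exact ⟨ε, h, h1, h2, h3⟩
  set lam := γ * c * (1 - c * ε / 2) with hlam
  set η := (lam - 1) / 2 with hη
  have hη0 : 0 < η := by rw [hη]; linarith
  have hlamη : lam = 1 + 2 * η := by rw [hη]; ring
  -- With lam = 1 + 2η, these ζ and z satisfy lam (1 - zζ) = η ≥ -log ζ, which is what the
  -- generation bound needs, with zζ < 1 and z > 1.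
  set ζ := (1 + η)⁻¹ with hζ
  set z := 1 + η ^ 2 / lam with hz
  have hlam0 : 0 < lam := by linarith
  have hz1 : 1 < z := by
    rw [hz]
    have : 0 < η ^ 2 / lam := by positivity
    linarith
  have hζ0 : 0 < ζ := by positivity
  have hkey : lam * (1 - z * ζ) = η := by
    rw [hz, hζ, hlamη]
    have : (1 : ℝ) + 2 * η ≠ 0 := by positivity
    field_simp
    ring
  have hzζ : 0 < 1 - z * ζ := by
    by_contra hcon
    have := mul_nonpos_of_nonneg_of_nonpos hlam0.le (not_lt.1 hcon)
    linarith
  have hlogζ : -η ≤ Real.log ζ := by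
    rw [hζ, Real.log_inv]
    have := Real.log_le_sub_one_of_pos (by positivity : 0 < 1 + η)
    linarith
  refine ⟨ε, hε0, hεε₀, Real.log z * ((1 - γ) / 4),
    mul_pos (Real.log_pos hz1) (by linarith), ?_⟩
  have hlarge1 : ∀ᶠ n : ℕ in atTop, c < n :=
    tendsto_natCast_atTop_atTop.eventually (eventually_gt_atTop c)
  have hlarge2 : ∀ᶠ n : ℕ in atTop, 1 / ((1 - γ) / 4) < n :=
    tendsto_natCast_atTop_atTop.eventually (eventually_gt_atTop _)
  filter_upwards [hlarge1, hlarge2] with n hn1 hn2 P hP hPq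
  have hn0 : (0 : ℝ) < n := hc0.trans hn1
  have hcn : c / n < 1 := (div_lt_one hn0).2 hn1
  have hcn0 : 0 < c / n := by positivity
  set K := ⌊ε * n⌋₊ with hK
  set R := ⌈γ * n⌉₊ with hR
  have hKn : (K : ℝ) ≤ ε * n := Nat.floor_le (by positivity)
  have hRn : γ * n ≤ (R : ℝ) := Nat.le_ceil _
  have hRn' : (R : ℝ) < γ * n + 1 := Nat.ceil_lt_add_one (by positivity)
  have hcond : ∀ s ≤ K, (1 - (1 - (1 - c / n) ^ s) * (1 - z * ζ)) ^ R ≤ ζ ^ s := by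
    intro s hs
    have hs' : (s : ℝ) ≤ ε * n := (Nat.cast_le.2 hs).trans hKn
    have h1 := one_sub_pow_ge hcn.le s (by positivity)
    have h2 : c / n * s / 2 ≤ c * ε / 2 := by
      have : c / n * s ≤ c / n * (ε * n) := by gcongr
      have e : c / n * (ε * n) = c * ε := by field_simp
      linarith
    have h3 : c / n * s * (1 - c * ε / 2) ≤ 1 - (1 - c / n) ^ s :=
      le_trans (mul_le_mul_of_nonneg_left (by linarith) (by positivity)) h1
    set Y := 1 - (1 - c / n) ^ s with hY
    have hY1 : Y ≤ 1 := by
      rw [hY]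
      have : 0 ≤ (1 - c / n) ^ s := pow_nonneg (by linarith) _
      linarith
    have hε2 : 0 < 1 - c * ε / 2 := by
      by_contra hcon
      have := mul_nonpos_of_nonneg_of_nonpos (by positivity : 0 ≤ γ * c) (not_lt.1 hcon)
      linarith
    have hY0 : 0 ≤ Y := le_trans (by positivity) h3
    have hzζ1 : 1 - z * ζ ≤ 1 := by
      have : 0 < z * ζ := by positivity
      linarith
    have hYz : Y * (1 - z * ζ) ≤ 1 := mul_le_one₀ hY1 hzζ.le hzζ1
    calc (1 - Y * (1 - z * ζ)) ^ R ≤ Real.exp (-(Y * (1 - z * ζ))) ^ R :=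
          pow_le_pow_left₀ (by linarith) (Real.one_sub_le_exp_neg _) R
      _ = Real.exp (-(R * (Y * (1 - z * ζ)))) := by
          rw [← Real.exp_nat_mul]; ring_nf
      _ ≤ Real.exp (s * Real.log ζ) := by
          refine Real.exp_le_exp.2 ?_
          have h4 : (s : ℝ) * η ≤ R * (Y * (1 - z * ζ)) := by
            calc (s : ℝ) * η = (γ * n) * (c / n * s * (1 - c * ε / 2) * (1 - z * ζ)) := by
                  rw [← hkey, hlam]; field_simp
              _ ≤ R * (Y * (1 - z * ζ)) := by gcongr
          have h5 := mul_le_mul_of_nonneg_left hlogζ (Nat.cast_nonneg (α := ℝ) s)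
          linarith
      _ = ζ ^ s := by
          rw [← Real.log_pow, Real.exp_log (by positivity)]
  have hmain := smallProb_le_of_reach (by linarith) (by linarith) hP hPq hz1.le hζ0.le
    (by linarith) hcond n
  -- A positive fraction of the vertices lies beyond R + K, each gaining a factor 1/z.
  have hbig : (R : ℝ) + K + (1 - γ) / 4 * n ≤ n := by
    have : 1 < (1 - γ) / 4 * n := by
      rw [div_lt_iff₀ (by linarith)] at hn2
      linarith
    nlinarith
  have hz0 : 0 < z := by linarith
  have hsp : smallProb (1 - c / n) P K n ≤ z ^ (R + K) / z ^ n := by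
    rw [le_div_iff₀ (by positivity)]
    exact hmain
  refine hsp.trans ?_
  rw [← Real.exp_log (by positivity : 0 < z ^ (R + K)), ← Real.exp_log (by positivity : 0 < z ^ n),
    ← Real.exp_sub, Real.log_pow, Real.log_pow]
  refine Real.exp_le_exp.2 ?_
  have hlz := Real.log_pos hz1
  push_cast
  have := mul_le_mul_of_nonneg_left hbig hlz.le
  linarith

/-! ### Moderate deviations of a component size -/

theorem exp_le_quadratic_add_cube {w : ℝ} (hw : |w| ≤ 1) :
    Real.exp w ≤ 1 + w + w ^ 2 / 2 + |w| ^ 3 := by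
  have h := Real.exp_bound hw (n := 3) (by norm_num)
  simp only [Finset.sum_range_succ, Finset.sum_range_zero, Nat.factorial] at h
  have h2 := (abs_le.1 h).2
  have h3 : 0 ≤ |w| ^ 3 := by positivity
  norm_num at h2
  linarith

/-- The cumulant generating function of a Bernoulli variable is quadratic to leading order. -/
theorem bernoulli_mgf_le {y t : ℝ} (hy0 : 0 ≤ y) (hy1 : y ≤ 1) (ht : |t| ≤ 1) :
    1 + y * (Real.exp t - 1) ≤ Real.exp (t * y + y * (1 - y) * t ^ 2 / 2 + |t| ^ 3) := by
  have h1 : |-(y * t)| ≤ 1 := by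
    rw [abs_neg, abs_mul, abs_of_nonneg hy0]
    exact mul_le_one₀ hy1 (abs_nonneg _) ht
  have h2 : |(1 - y) * t| ≤ 1 := by
    rw [abs_mul, abs_of_nonneg (by linarith : 0 ≤ 1 - y)]
    exact mul_le_one₀ (by linarith) (abs_nonneg _) ht
  have e1 := exp_le_quadratic_add_cube h1
  have e2 := exp_le_quadratic_add_cube h2
  rw [abs_neg, abs_mul, abs_of_nonneg hy0] at e1
  rw [abs_mul, abs_of_nonneg (by linarith : 0 ≤ 1 - y)] at e2
  have h3 : (y * |t|) ^ 3 ≤ |t| ^ 3 := by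
    gcongr
    exact mul_le_of_le_one_left (abs_nonneg _) hy1
  have h4 : ((1 - y) * |t|) ^ 3 ≤ |t| ^ 3 := by
    gcongr
    exact mul_le_of_le_one_left (abs_nonneg _) (by linarith)
  -- The centred variable has no first-order term, and its second-order term is the variance y(1 -
  -- y).
  have h5 : (1 - y) * Real.exp (-(y * t)) + y * Real.exp ((1 - y) * t) ≤
      1 + (y * (1 - y) * t ^ 2 / 2 + |t| ^ 3) := by
    have a1 := mul_le_mul_of_nonneg_left (e1.trans (add_le_add_right h3 _))
      (by linarith : 0 ≤ 1 - y)
    have a2 := mul_le_mul_of_nonneg_left (e2.trans (add_le_add_right h4 _)) hy0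
    calc _ ≤ _ := add_le_add a1 a2
      _ = _ := by ring
  have h6 : 1 + y * (Real.exp t - 1) =
      Real.exp (t * y) * ((1 - y) * Real.exp (-(y * t)) + y * Real.exp ((1 - y) * t)) := by
    have b1 : Real.exp (t * y) * Real.exp (-(y * t)) = 1 := by
      rw [← Real.exp_add]; ring_nf; simp
    have b2 : Real.exp (t * y) * Real.exp ((1 - y) * t) = Real.exp t := by
      rw [← Real.exp_add]; ring_nf
    linear_combination (-(1 - y)) * b1 - y * b2
  rw [h6, add_assoc, Real.exp_add]
  refine mul_le_mul_of_nonneg_left (h5.trans ?_) (Real.exp_pos _).le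
  have := Real.add_one_le_exp (y * (1 - y) * t ^ 2 / 2 + |t| ^ 3)
  linarith

theorem abs_pow_sub_pow_le {a b : ℝ} (ha0 : 0 ≤ a) (ha1 : a ≤ 1) (hb0 : 0 ≤ b) (hb1 : b ≤ 1)
    (l : ℕ) : |a ^ l - b ^ l| ≤ l * |a - b| := by
  induction l with
  | zero => simp
  | succ l ih =>
    have e : a ^ (l + 1) - b ^ (l + 1) = (a ^ l - b ^ l) * a + b ^ l * (a - b) := by ring
    rw [e]
    refine (abs_add_le _ _).trans ?_
    rw [abs_mul, abs_mul, abs_of_nonneg ha0, abs_of_nonneg (pow_nonneg hb0 l)]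
    have h1 : |a ^ l - b ^ l| * a ≤ |a ^ l - b ^ l| := mul_le_of_le_one_right (abs_nonneg _) ha1
    have h2 : b ^ l * |a - b| ≤ |a - b| :=
      mul_le_of_le_one_left (abs_nonneg _) (pow_le_one₀ hb0 hb1)
    push_cast
    linarith

/-- The error is c²/n uniformly in l, hence negligible against δ because nδ → ∞. -/
theorem abs_one_sub_pow_sub_exp_le {c : ℝ} (hc : 0 < c) {n l : ℕ} (hcn : c < n) (hl : l ≤ n) :
    |(1 - c / n) ^ l - Real.exp (-(c * (l / n)))| ≤ c ^ 2 / n := by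
  have hn0 : (0 : ℝ) < n := hc.trans hcn
  have hcn1 : c / n < 1 := (div_lt_one hn0).2 hcn
  have hcn0 : 0 < c / n := by positivity
  have e : Real.exp (-(c * (l / n))) = Real.exp (-(c / n)) ^ l := by
    rw [← Real.exp_nat_mul]; ring_nf
  rw [e]
  refine (abs_pow_sub_pow_le (by linarith) (by linarith) (Real.exp_pos _).le
    (Real.exp_le_one_iff.2 (by linarith)) l).trans ?_
  have h1 := Real.abs_exp_sub_one_sub_id_le (x := -(c / n))
    (by rw [abs_neg, abs_of_pos hcn0]; exact hcn1.le)
  have h2 : |1 - c / n - Real.exp (-(c / n))| ≤ (c / n) ^ 2 := by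
    rw [abs_sub_comm]
    calc _ = |Real.exp (-(c / n)) - 1 - -(c / n)| := by ring_nf
      _ ≤ _ := by rwa [neg_sq] at h1
  calc (l : ℝ) * |1 - c / n - Real.exp (-(c / n))| ≤ n * (c / n) ^ 2 := by gcongr
    _ = c ^ 2 / n := by field_simp

section

variable {c T : ℝ}

/-- The fixed-point equation 1 - ρ = exp(-cρ) for ρ = 1 - T/c, another form of the duality between T
and c. -/
theorem exp_neg_mul_giant (hc : 1 < c) (hTc : T * Real.exp (-T) = c * Real.exp (-c)) :
    Real.exp (-(c * (1 - T / c))) = T / c := by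
  have hc0 : c ≠ 0 := by positivity
  have h1 : -(c * (1 - T / c)) = -c + T := by field_simp; ring
  have h2 : Real.exp (-T) * Real.exp T = 1 := by rw [← Real.exp_add]; simp
  rw [h1, Real.exp_add, eq_div_iff hc0]
  linear_combination (-Real.exp T) * hTc + T * h2

/-- The function `x - (1 - exp (-c x))`, which is convex and vanishes at `1 - T / c` with
slope `1 - T`, is bounded away from zero. -/
theorem exists_abs_sub_ge (hc : 1 < c) (hT : T ∈ Set.Ioo (0 : ℝ) 1)
    (hTc : T * Real.exp (-T) = c * Real.exp (-c)) {ε : ℝ} (hε : 0 < ε) (hερ : ε < 1 - T / c)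
    {r : ℝ} (hr0 : 0 < r) (hr : r < 1) :
    ∃ κ > 0, ∃ δ₀ > 0, ∀ x, ε ≤ x →
      κ * |x - (1 - T / c)| ≤ |x - (1 - Real.exp (-(c * x)))| ∧
      ∀ δ, 0 < δ → δ ≤ δ₀ → δ ≤ |x - (1 - T / c)| →
        r * (1 - T) * δ ≤ |x - (1 - Real.exp (-(c * x)))| := by
  obtain ⟨hT0, hT1⟩ := hT
  have hc0 : 0 < c := by linarith
  have hexp := exp_neg_mul_giant hc hTc
  have hTc1 : T / c = 1 - (1 - T / c) := by ring
  set ρ := 1 - T / c with hρ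
  have hρ0 : 0 < ρ := hε.trans hερ
  have hcρ : c * (1 - ρ) = T := by rw [hρ]; field_simp; ring
  rw [hTc1] at hexp
  -- to the right of the zero, the tangent bounds the function from below
  have hright : ∀ x, ρ ≤ x → (1 - T) * |x - ρ| ≤ |x - (1 - Real.exp (-(c * x)))| := by
    intro x hx
    have h1 : Real.exp (-(c * x)) = (1 - ρ) * Real.exp (-(c * (x - ρ))) := by
      rw [← hexp, ← Real.exp_add]; ring_nf
    have h2 := Real.one_sub_le_exp_neg (c * (x - ρ))
    have h3 : 0 ≤ 1 - ρ := by rw [← hexp]; exact (Real.exp_pos _).le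
    have h4 := mul_le_mul_of_nonneg_left h2 h3
    rw [abs_of_nonneg (by linarith : 0 ≤ x - ρ)]
    refine le_trans ?_ (le_abs_self _)
    rw [h1]
    have h5 : (1 - ρ) * (1 - c * (x - ρ)) = (1 - ρ) - T * (x - ρ) := by rw [← hcρ]; ring
    linarith
  -- The convex function has the zeros 0 and ρ, so it is strictly negative at ε in between.
  have hεneg : Real.exp (-(c * ε)) < 1 - ε := by
    have h := strictConvexOn_exp.2 (Set.mem_univ 0) (Set.mem_univ (-(c * ρ)))
      (by have := mul_pos hc0 hρ0; linarith)
      (show 0 < 1 - ε / ρ by have := (div_lt_one hρ0).2 hερ; linarith)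
      (show 0 < ε / ρ by positivity) (by ring)
    simp only [smul_eq_mul, mul_zero, zero_add, Real.exp_zero, mul_one, hexp] at h
    have e1 : ε / ρ * -(c * ρ) = -(c * ε) := by field_simp
    have e2 : 1 - ε / ρ + ε / ρ * (1 - ρ) = 1 - ε := by field_simp; ring
    rwa [e1, e2] at h
  set κ₀ := (1 - ε - Real.exp (-(c * ε))) / (ρ - ε) with hκ₀
  have hκ₀0 : 0 < κ₀ := div_pos (by linarith) (by linarith)
  -- between `ε` and the zero, the chord bounds the function from above
  have hleft : ∀ x, ε ≤ x → x ≤ ρ → κ₀ * |x - ρ| ≤ |x - (1 - Real.exp (-(c * x)))| := by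
    intro x hx1 hx2
    have hd : 0 < ρ - ε := by linarith
    have h := convexOn_exp.2 (Set.mem_univ (-(c * ε))) (Set.mem_univ (-(c * ρ)))
      (show 0 ≤ (ρ - x) / (ρ - ε) from div_nonneg (by linarith) hd.le)
      (show 0 ≤ (x - ε) / (ρ - ε) from div_nonneg (by linarith) hd.le) (by field_simp; ring)
    simp only [smul_eq_mul, hexp] at h
    have e1 : (ρ - x) / (ρ - ε) * -(c * ε) + (x - ε) / (ρ - ε) * -(c * ρ) = -(c * x) := by
      field_simp; ring
    rw [e1] at h
    have e2 : κ₀ * (ρ - x) = 1 - x - ((ρ - x) / (ρ - ε) * Real.exp (-(c * ε)) +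
        (x - ε) / (ρ - ε) * (1 - ρ)) := by
      rw [hκ₀]; field_simp; ring
    rw [abs_of_nonpos (by linarith : x - ρ ≤ 0)]
    refine le_trans ?_ (neg_le_abs _)
    linarith
  set κ := min κ₀ (1 - T) with hκ
  have hκ0 : 0 < κ := lt_min hκ₀0 (by linarith)
  have hall : ∀ x, ε ≤ x → κ * |x - ρ| ≤ |x - (1 - Real.exp (-(c * x)))| := by
    intro x hx
    rcases le_total x ρ with h | h
    · exact (mul_le_mul_of_nonneg_right (min_le_left _ _) (abs_nonneg _)).trans (hleft x hx h)
    · exact (mul_le_mul_of_nonneg_right (min_le_right _ _) (abs_nonneg _)).trans (hright x h)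
  -- Within η to the left of ρ, the quadratic error of the exponential reduces the slope 1 - T by at
  -- most the factor r. Farther left, κη bounds the function from below, which explains the
  -- threshold κη/(1 - T) for δ.
  set η := (1 - r) * (1 - T) / c with hη
  have hη0 : 0 < η := div_pos (mul_pos (by linarith) (by linarith)) hc0
  have hcη : c * η = (1 - r) * (1 - T) := by rw [hη]; field_simp
  have hcη1 : c * η ≤ 1 := by
    rw [hcη]
    exact mul_le_one₀ (by linarith) (by linarith) (by linarith)
  refine ⟨κ, hκ0, κ * η / (1 - T), div_pos (mul_pos hκ0 hη0) (by linarith),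
    fun x hx => ⟨hall x hx, fun δ hδ0 hδ hδx => ?_⟩⟩
  have h1T : 0 < 1 - T := by linarith
  rcases le_total ρ x with h | h
  · refine le_trans ?_ (hright x h)
    have h1 : r * (1 - T) ≤ 1 - T := mul_le_of_le_one_left h1T.le hr.le
    exact mul_le_mul h1 hδx hδ0.le h1T.le
  rw [abs_of_nonpos (by linarith : x - ρ ≤ 0)] at hδx
  rcases le_total (ρ - x) η with hu | hu
  · have h1 : Real.exp (-(c * x)) = (1 - ρ) * Real.exp (c * (ρ - x)) := by
      rw [← hexp, ← Real.exp_add]; ring_nf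
    have hcu0 : 0 ≤ c * (ρ - x) := mul_nonneg hc0.le (by linarith)
    have hcu : c * (ρ - x) ≤ (1 - r) * (1 - T) := by
      rw [← hcη]; exact mul_le_mul_of_nonneg_left hu hc0.le
    have h2 := (abs_le.1 (Real.abs_exp_sub_one_sub_id_le (x := c * (ρ - x))
      (by rw [abs_of_nonneg hcu0, ← hcη] at *; linarith))).2
    have h3 : 0 ≤ 1 - ρ := by rw [← hexp]; exact (Real.exp_pos _).le
    refine le_trans ?_ (neg_le_abs _)
    rw [h1]
    set u := ρ - x with hu'
    have hu0 : 0 ≤ u := by linarith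
    have h4 : (1 - ρ) * Real.exp (c * u) ≤ (1 - ρ) * (1 + c * u + (c * u) ^ 2) :=
      mul_le_mul_of_nonneg_left (by linarith) h3
    have h5 : (1 - ρ) * (1 + c * u + (c * u) ^ 2) = (1 - ρ) + T * u + T * u * (c * u) := by
      rw [← hcρ]; ring
    have h6 : T * u * (c * u) ≤ u * ((1 - r) * (1 - T)) :=
      mul_le_mul (mul_le_of_le_one_left hu0 hT1.le) hcu hcu0 hu0
    have h7 : r * (1 - T) * δ ≤ r * (1 - T) * u :=
      mul_le_mul_of_nonneg_left (by linarith) (mul_nonneg hr0.le h1T.le)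
    have h8 : x = ρ - u := by rw [hu']; ring
    rw [h8]
    linarith
  · refine le_trans ?_ (hall x hx)
    rw [abs_of_nonpos (by linarith : x - ρ ≤ 0)]
    rw [le_div_iff₀ h1T] at hδ
    have h1 : r * (1 - T) * δ ≤ δ * (1 - T) := by
      have := mul_le_of_le_one_left (mul_pos h1T hδ0).le hr.le
      linarith
    have h2 : κ * η ≤ κ * -(x - ρ) := mul_le_mul_of_nonneg_left (by linarith) hκ0.le
    linarith

end

theorem abs_exp_sub_exp_le {a b : ℝ} (ha : a ≤ 0) (hb : b ≤ 0) :
    |Real.exp a - Real.exp b| ≤ |a - b| := by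
  wlog hab : a ≤ b generalizing a b
  · rw [abs_sub_comm, abs_sub_comm a]
    exact this hb ha (le_of_not_ge hab)
  rw [abs_of_nonpos (by have := Real.exp_le_exp.2 hab; linarith), abs_of_nonpos (by linarith)]
  have h1 : Real.exp a = Real.exp b * Real.exp (a - b) := by rw [← Real.exp_add]; ring_nf
  have h2 := Real.add_one_le_exp (a - b)
  have h3 := Real.exp_le_one_iff.2 hb
  have h4 : Real.exp b * (1 - Real.exp (a - b)) ≤ 1 - Real.exp (a - b) :=
    mul_le_of_le_one_left (by have := Real.exp_le_one_iff.2 (by linarith : a - b ≤ 0); linarith) h3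
  rw [h1]
  linarith

/-- Optimisation of Chernoff's exponent for a Bernoulli parameter `y` that is close to `ρ`. -/
theorem exists_chernoff_exponent {ρ x y A D : ℝ} (hρ0 : 0 < ρ) (hρ1 : ρ < 1) (hy0 : 0 ≤ y)
    (hy1 : y ≤ 1) (hD : 0 < D) (hDx : D ≤ |x - y|) (hA : |y - ρ| ≤ A * |x - y|)
    (hτ : D / (ρ * (1 - ρ)) ≤ 1) (hAτ : A * (D / (ρ * (1 - ρ))) ≤ 2) :
    ∃ t, |t| ≤ 1 ∧ -(t * x) + (t * y + y * (1 - y) * t ^ 2 / 2 + |t| ^ 3) ≤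
      -(D ^ 2 / (2 * (ρ * (1 - ρ))) * (1 - (A / (ρ * (1 - ρ)) + 2 / (ρ * (1 - ρ)) ^ 2) * D)) := by
  set v := ρ * (1 - ρ) with hv
  have hv0 : 0 < v := mul_pos hρ0 (by linarith)
  set τ := D / v with hτ'
  have hτ0 : 0 < τ := div_pos hD hv0
  -- The tilt is optimal for deviation D and not for |x - y|, which may be much larger. It stays
  -- small, and the exponent only improves as |x - y| grows.
  obtain ⟨t, ht1, ht2⟩ : ∃ t, |t| = τ ∧ t * (x - y) = τ * |x - y| := by
    rcases le_total 0 (x - y) with h | h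
    · exact ⟨τ, abs_of_pos hτ0, by rw [abs_of_nonneg h]⟩
    · exact ⟨-τ, by rw [abs_neg, abs_of_pos hτ0], by rw [abs_of_nonpos h]; ring⟩
  refine ⟨t, by rw [ht1]; exact hτ, ?_⟩
  have ht3 : t ^ 2 = τ ^ 2 := by rw [← sq_abs, ht1]
  rw [ht1, ht3]
  set w := |x - y|
  -- The variance at y exceeds that at ρ by at most |y - ρ|.
  have h1 : y * (1 - y) ≤ v + A * w := by
    have e : y * (1 - y) - v = (y - ρ) * (1 - y - ρ) := by rw [hv]; ring
    have h2 : (y - ρ) * (1 - y - ρ) ≤ |y - ρ| := by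
      refine (le_abs_self _).trans ?_
      rw [abs_mul]
      exact mul_le_of_le_one_right (abs_nonneg _) (abs_le.2 ⟨by linarith, by linarith⟩)
    linarith
  have h2 : y * (1 - y) * τ ^ 2 / 2 ≤ (v + A * w) * τ ^ 2 / 2 := by gcongr
  have h3 : τ * D * (1 - A * τ / 2) ≤ τ * w * (1 - A * τ / 2) := by
    refine mul_le_mul_of_nonneg_right ?_ (by linarith)
    exact mul_le_mul_of_nonneg_left hDx hτ0.le
  have h4 : -(τ * D * (1 - A * τ / 2)) + v * τ ^ 2 / 2 + τ ^ 3 =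
      -(D ^ 2 / (2 * v) * (1 - (A / v + 2 / v ^ 2) * D)) := by
    rw [hτ']; field_simp; ring
  rw [← h4]
  linarith

/-- Moderate deviations of the size of a component that is not small. -/
theorem eventually_meanComp_le {c T : ℝ} (hc : 1 < c) (hT : T ∈ Set.Ioo (0 : ℝ) 1)
    (hTc : T * Real.exp (-T) = c * Real.exp (-c)) {ε : ℝ} (hε : 0 < ε) (hερ : ε < 1 - T / c)
    {r : ℝ} (hr0 : 0 < r) (hr : r < 1) {δ : ℕ → ℝ} (hδ0 : ∀ᶠ n in atTop, 0 < δ n)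
    (hδ : Tendsto δ atTop (𝓝 0)) (hnδ : Tendsto (fun n : ℕ => n * δ n) atTop atTop) :
    ∀ᶠ n : ℕ in atTop, ∀ P : ℕ → ℝ, IsConnSeq (1 - c / n) P → ∀ l : ℕ, ε * n ≤ l → l ≤ n →
      δ n ≤ |(l : ℝ) / n - (1 - T / c)| →
      meanComp (1 - c / n) P n l ≤ n / c * Real.exp (-(r * (n * δ n ^ 2) *
        ((1 - T) ^ 2 / (2 * ((1 - T / c) * (T / c)))))) := by
  have hc0 : 0 < c := by linarith
  have h1T : 0 < 1 - T := by linarith [hT.2]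
  -- A factor s is lost in the slope, another in replacing 1 - exp(-cx) by y; squared they give s⁴,
  -- and the Chernoff correction takes a fifth. Bernoulli's inequality yields s⁵ ≥ r.
  set s := 1 - (1 - r) / 5 with hs
  have hs0 : 0 < s := by rw [hs]; linarith
  have hs1 : s < 1 := by rw [hs]; linarith
  have hs5 : r ≤ s ^ 5 := by
    have := one_add_mul_le_pow (a := -((1 - r) / 5)) (by linarith) 5
    rw [hs, sub_eq_add_neg 1 ((1 - r) / 5)]
    push_cast at this
    linarith
  obtain ⟨κ, hκ, δ₀, hδ₀, hg⟩ := exists_abs_sub_ge hc hT hTc hε hερ hs0 hs1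
  have hexp : Real.exp (-(c * (1 - T / c))) = 1 - (1 - T / c) :=
    (exp_neg_mul_giant hc hTc).trans (by ring)
  rw [show (1 - T / c) * (T / c) = (1 - T / c) * (1 - (1 - T / c)) by ring]
  have hρ1 : 1 - T / c < 1 := by have := div_pos hT.1 hc0; linarith
  set ρ := 1 - T / c with hρ
  have hρ0 : 0 < ρ := hε.trans hερ
  set v := ρ * (1 - ρ) with hv
  have hv0 : 0 < v := mul_pos hρ0 (by linarith)
  -- From |y - ρ| ≤ g + c|x - ρ|, |x - ρ| ≤ g/κ and g ≤ |x - y|/s, where g = |x - (1 - exp(-cx))|.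
  set A := (1 + c / κ) / s with hA
  have hA0 : 0 < A := by positivity
  set D : ℕ → ℝ := fun n => s ^ 2 * (1 - T) * δ n with hD
  have hDlim : Tendsto D atTop (𝓝 0) := by
    have := hδ.const_mul (s ^ 2 * (1 - T))
    rwa [mul_zero] at this
  have hD1 : ∀ᶠ n in atTop, D n / v ≤ 1 := by
    have : Tendsto (fun n => D n / v) atTop (𝓝 (0 / v)) := hDlim.div_const v
    rw [zero_div] at this
    exact this.eventually (ge_mem_nhds one_pos)
  have hD2 : ∀ᶠ n in atTop, A * (D n / v) ≤ 2 := by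
    have : Tendsto (fun n => A * (D n / v)) atTop (𝓝 (A * (0 / v))) :=
      (hDlim.div_const v).const_mul A
    rw [zero_div, mul_zero] at this
    exact this.eventually (ge_mem_nhds two_pos)
  have hD3 : ∀ᶠ n in atTop, (A / v + 2 / v ^ 2) * D n ≤ 1 - s := by
    have : Tendsto (fun n => (A / v + 2 / v ^ 2) * D n) atTop (𝓝 ((A / v + 2 / v ^ 2) * 0)) :=
      hDlim.const_mul _
    rw [mul_zero] at this
    exact this.eventually (ge_mem_nhds (by linarith))
  have hnc : ∀ᶠ n : ℕ in atTop, c < n :=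
    tendsto_natCast_atTop_atTop.eventually (eventually_gt_atTop c)
  filter_upwards [hδ0, hD1, hD2, hD3, hnc, hδ.eventually (ge_mem_nhds hδ₀),
    hnδ.eventually (eventually_ge_atTop (c ^ 2 / ((1 - s) * (s * (1 - T)))))] with
    n hδn hD1 hD2 hD3 hcn hδδ₀ hnδn P hP l hl1 hl2 hlδ
  have hn0 : (0 : ℝ) < n := hc0.trans hcn
  have hl0 : 1 ≤ l := by
    have : (0 : ℝ) < l := lt_of_lt_of_le (by positivity) hl1
    exact_mod_cast this
  have hcn1 : c / n < 1 := (div_lt_one hn0).2 hcn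
  have hcn0 : 0 < c / n := by positivity
  set x := (l : ℝ) / n with hx
  have hxε : ε ≤ x := by rw [hx, le_div_iff₀ hn0]; exact hl1
  obtain ⟨hg1, hg2⟩ := hg x hxε
  have hg2 := hg2 (δ n) hδn hδδ₀ hlδ
  set g := |x - (1 - Real.exp (-(c * x)))| with hgdef
  set y := 1 - (1 - c / n) ^ l with hy
  have hy0 : 0 ≤ y := sub_nonneg.2 (pow_le_one₀ (by linarith) (by linarith))
  have hy1 : y ≤ 1 := by
    have : 0 ≤ (1 - c / n) ^ l := pow_nonneg (by linarith) _
    linarith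
  have hyy : |y - (1 - Real.exp (-(c * x)))| ≤ c ^ 2 / n := by
    have := abs_one_sub_pow_sub_exp_le hc0 hcn hl2
    rw [abs_sub_comm] at this
    convert this using 2
    rw [hy]; ring
  have hsmall : c ^ 2 / n ≤ (1 - s) * g := by
    have hpos : 0 < (1 - s) * (s * (1 - T)) := by
      have : 0 < 1 - s := by linarith
      positivity
    rw [div_le_iff₀ hpos] at hnδn
    rw [div_le_iff₀ hn0]
    have := mul_le_mul_of_nonneg_left hg2 (mul_nonneg (by linarith : 0 ≤ 1 - s) hn0.le)
    linarith
  have hg0 : 0 ≤ g := abs_nonneg _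
  have hxy : s * g ≤ |x - y| := by
    have h1 : g ≤ |x - y| + |y - (1 - Real.exp (-(c * x)))| := by
      have := abs_add_le (x - y) (y - (1 - Real.exp (-(c * x))))
      rwa [sub_add_sub_cancel] at this
    linarith
  have hDx : D n ≤ |x - y| := by
    refine le_trans ?_ hxy
    have := mul_le_mul_of_nonneg_left hg2 hs0.le
    simp only [hD]
    linarith
  have hDpos : 0 < D n := by simp only [hD]; positivity
  have hyρ : |y - ρ| ≤ A * |x - y| := by
    have h1 : |(1 - Real.exp (-(c * x))) - ρ| ≤ c * |x - ρ| := by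
      have h2 := abs_exp_sub_exp_le (a := -(c * ρ)) (b := -(c * x))
        (by have := mul_pos hc0 hρ0; linarith)
        (by have := mul_pos hc0 (hε.trans_le hxε); linarith)
      have e1 : -(c * ρ) - -(c * x) = c * (x - ρ) := by ring
      rw [hexp, e1, abs_mul, abs_of_pos hc0] at h2
      convert h2 using 2
      ring
    have h2 : |x - ρ| ≤ g / κ := by
      rw [le_div_iff₀ hκ, mul_comm]; exact hg1
    have h3 : |y - ρ| ≤ |y - (1 - Real.exp (-(c * x)))| + |(1 - Real.exp (-(c * x))) - ρ| := by
      have := abs_add_le (y - (1 - Real.exp (-(c * x)))) ((1 - Real.exp (-(c * x))) - ρ)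
      rwa [sub_add_sub_cancel] at this
    have h4 : |y - ρ| ≤ (1 + c / κ) * g := by
      have h5 := mul_le_mul_of_nonneg_left h2 hc0.le
      have h6 : c * (g / κ) = c / κ * g := by ring
      have h7 := mul_nonneg hs0.le hg0
      linarith
    refine h4.trans ?_
    calc (1 + c / κ) * g = A * (s * g) := by rw [hA]; field_simp
      _ ≤ A * |x - y| := mul_le_mul_of_nonneg_left hxy hA0.le
  obtain ⟨t, ht1, ht2⟩ := exists_chernoff_exponent hρ0 hρ1 hy0 hy1 hDpos hDx hyρ hD1 hD2
  have hmc := meanComp_le (by linarith) (by linarith) hP n l hl0 hl2 t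
  have hmgf := bernoulli_mgf_le hy0 hy1 ht1
  have hmgf0 : 0 ≤ 1 + y * (Real.exp t - 1) := by
    have := mul_nonneg hy0 (Real.exp_pos t).le
    linarith
  refine hmc.trans ?_
  rw [sub_sub_cancel, inv_div]
  refine mul_le_mul_of_nonneg_left ?_ (by positivity)
  calc Real.exp (-(t * l)) * (1 + y * (Real.exp t - 1)) ^ n
      ≤ Real.exp (-(t * l)) * Real.exp (t * y + y * (1 - y) * t ^ 2 / 2 + |t| ^ 3) ^ n := by
        gcongr
    _ = Real.exp (n * (-(t * x) + (t * y + y * (1 - y) * t ^ 2 / 2 + |t| ^ 3))) := by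
        rw [← Real.exp_nat_mul, ← Real.exp_add, hx]
        congr 1
        field_simp
    _ ≤ _ := by
        refine Real.exp_le_exp.2 ?_
        have h1 : D n ^ 2 / (2 * v) * s ≤
            D n ^ 2 / (2 * v) * (1 - (A / v + 2 / v ^ 2) * D n) :=
          mul_le_mul_of_nonneg_left (by linarith) (by positivity)
        have h2 : r * δ n ^ 2 * ((1 - T) ^ 2 / (2 * v)) ≤ D n ^ 2 / (2 * v) * s := by
          have e : D n ^ 2 / (2 * v) * s = s ^ 5 * δ n ^ 2 * ((1 - T) ^ 2 / (2 * v)) := by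
            simp only [hD]; ring
          rw [e]
          gcongr
        have h3 : -(t * x) + (t * y + y * (1 - y) * t ^ 2 / 2 + |t| ^ 3) ≤
            -(r * δ n ^ 2 * ((1 - T) ^ 2 / (2 * v))) := by linarith
        have h4 := mul_le_mul_of_nonneg_left h3 hn0.le
        linarith

/-! ### The conditional law of the largest jump -/

section

variable {c θ : ℝ} {n : ℕ} {Ω : Type*} [MeasurableSpace Ω] {μ : Measure Ω} [IsProbabilityMeasure μ]
  {N : Ω → ℕ} {X : ℕ → Ω → ℕ}

omit [MeasurableSpace Ω] in
theorem maxJump_le_totalJump (N : Ω → ℕ) (X : ℕ → Ω → ℕ) (ω : Ω) :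
    maxJump N X ω ≤ totalJump N X ω :=
  Finset.sup_le fun _ hi => Finset.single_le_sum (f := fun i => X i ω) (fun _ _ => Nat.zero_le _) hi

/-- The conditional law of the largest jump, compared with the expected numbers of components
of the binomial random graph. -/
theorem IsJumpModel.exists_bounds (h : IsJumpModel c θ n μ N X) (hc : 0 < c) (hcn : c < n)
    (A : Set ℕ) [DecidablePred (· ∈ A)] {K : ℕ} (hK : K ≤ ⌊θ * n⌋₊) :
    ∃ C > 0,
      μ.real {ω | totalJump N X ω = n ∧ maxJump N X ω ∈ A} ≤
        C * (smallProb (1 - c / n) (fun k => connProb k (c / n)) K n +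
          ∑ l ∈ Finset.Ioc K n with l ∈ A,
            meanComp (1 - c / n) (fun k => connProb k (c / n)) n l) ∧
      C * (1 - ∑ l ∈ Finset.Ioc ⌊θ * n⌋₊ n,
        meanComp (1 - c / n) (fun k => connProb k (c / n)) n l) ≤
          μ.real {ω | totalJump N X ω = n} := by
  have hn : (0 : ℝ) < n := hc.trans hcn
  have hcn1 : c / n < 1 := (div_lt_one hn).2 hcn
  have hcn0 : 0 < c / n := by positivity
  have hq0 : 0 < 1 - c / n := by linarith
  have hPq : IsConnSeq (1 - c / n) (fun k => connProb k (c / n)) :=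
    isConnSeq_connProb ⟨c / n, hcn0.le, hcn1.le⟩
  have hP : ∀ k, 0 ≤ connProb k (c / n) := fun k => connProb_nonneg k _
  set P : ℕ → ℝ := fun k => connProb k (c / n) with hPdef
  set S := ⌊θ * n⌋₊
  set C := Real.exp (-(partitionZ c θ n * n)) * ((n : ℝ) ^ n / (n.factorial : ℝ) *
        (1 - c / n) ^ ((n : ℝ) * n - (n : ℝ) ^ 2 / 2)) with hC
  have hC0 : 0 < C := by positivity
  have hF : ∀ L, μ.real {ω | totalJump N X ω = n ∧ maxJump N X ω ≤ L} =
      C * smallProb (1 - c / n) P (min L S) n := fun L => h.real_total_max hc hcn L n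
  refine ⟨C, hC0, ?_, ?_⟩
  · have hsub : {ω | totalJump N X ω = n ∧ maxJump N X ω ∈ A} ⊆
        {ω | totalJump N X ω = n ∧ maxJump N X ω ≤ K} ∪
          ⋃ l ∈ (Finset.Ioc K n).filter (· ∈ A),
            {ω | totalJump N X ω = n ∧ maxJump N X ω ∈ ({l} : Set ℕ)} := by
      rintro ω ⟨h1, h2⟩
      have h3 := maxJump_le_totalJump N X ω
      rcases le_or_gt (maxJump N X ω) K with h4 | h4
      · exact Or.inl ⟨h1, h4⟩
      · refine Or.inr (Set.mem_biUnion (x := maxJump N X ω) ?_ ⟨h1, rfl⟩)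
        exact Finset.mem_coe.2 (Finset.mem_filter.2 ⟨Finset.mem_Ioc.2 ⟨h4, h1 ▸ h3⟩, h2⟩)
    have hone : ∀ l ∈ (Finset.Ioc K n).filter (· ∈ A),
        μ.real {ω | totalJump N X ω = n ∧ maxJump N X ω ∈ ({l} : Set ℕ)} ≤
          C * meanComp (1 - c / n) P n l := by
      intro l hl
      obtain ⟨l, rfl⟩ : ∃ l', l = l' + 1 :=
        ⟨l - 1, by have := (Finset.mem_Ioc.1 (Finset.mem_filter.1 hl).1).1; omega⟩
      have hdiff : {ω | totalJump N X ω = n ∧ maxJump N X ω ∈ ({l + 1} : Set ℕ)} =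
          {ω | totalJump N X ω = n ∧ maxJump N X ω ≤ l + 1} \
            {ω | totalJump N X ω = n ∧ maxJump N X ω ≤ l} := by
        ext ω
        simp only [Set.mem_sdiff, Set.mem_ofPred_eq, Set.mem_singleton_iff]
        constructor
        · rintro ⟨h1, h2⟩
          exact ⟨⟨h1, h2.le⟩, fun h3 => by omega⟩
        · rintro ⟨⟨h1, h2⟩, h3⟩
          exact ⟨h1, by by_contra h4; exact h3 ⟨h1, by omega⟩⟩
      have hss : {ω | totalJump N X ω = n ∧ maxJump N X ω ≤ l} ⊆
          {ω | totalJump N X ω = n ∧ maxJump N X ω ≤ l + 1} :=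
        fun ω hω => ⟨hω.1, hω.2.trans (Nat.le_succ l)⟩
      rw [hdiff, measureReal_sdiff hss (h.measurableSet_total_max n (Set.Iic l)), hF, hF, ← mul_sub]
      refine mul_le_mul_of_nonneg_left ?_ hC0.le
      -- Raising the cap from l to l + 1 admits at most the single new size l + 1, even after
      -- truncation at ⌊θn⌋.
      refine (smallProb_sub_le hq0.le hP hPq _ _ _).trans ?_
      calc _ ≤ ∑ k ∈ {l + 1}, meanComp (1 - c / n) P n k := by
            refine Finset.sum_le_sum_of_subset_of_nonneg ?_ fun k _ _ =>
              meanComp_nonneg hq0.le hP _ _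
            intro k hk
            have := Finset.mem_Ioc.1 hk
            rw [Finset.mem_singleton]
            omega
        _ = _ := Finset.sum_singleton _ _
    refine (measureReal_mono hsub).trans ((measureReal_union_le _ _).trans ?_)
    rw [mul_add, Finset.mul_sum]
    refine add_le_add ?_ ((measureReal_biUnion_finset_le _ _).trans (Finset.sum_le_sum hone))
    rw [hF, min_eq_left hK]
  -- A cap of at least n is no restriction on n vertices, so only components larger than θn are
  -- lost. The maximum with S makes the cap on the jumps void.
  · have h1 : {ω | totalJump N X ω = n ∧ maxJump N X ω ≤ max n S} ⊆
        {ω | totalJump N X ω = n} := fun ω hω => hω.1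
    refine le_trans ?_ (measureReal_mono h1)
    rw [hF, min_eq_right (le_max_right _ _)]
    refine mul_le_mul_of_nonneg_left ?_ hC0.le
    have h2 := smallProb_sub_le hq0.le hP hPq S (max n S) n
    rw [smallProb_of_le hPq (le_max_left _ _)] at h2
    have h3 : ∑ l ∈ Finset.Ioc S (max n S), meanComp (1 - c / n) P n l =
        ∑ l ∈ Finset.Ioc S n, meanComp (1 - c / n) P n l := by
      symm
      refine Finset.sum_subset (Finset.Ioc_subset_Ioc_right (le_max_left _ _)) fun l hl hl' => ?_
      rw [Finset.mem_Ioc] at hl hl'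
      rw [meanComp, Nat.choose_eq_zero_of_lt (by omega)]
      simp
    linarith

end

/-- The moderate deviation bound for the conditional probability, in exponential form. -/
theorem eventually_cond_le (c T θ : ℝ) (hc : 1 < c) (hT : T ∈ Set.Ioo (0 : ℝ) 1)
    (hTc : T * Real.exp (-T) = c * Real.exp (-c)) (hθ : 1 - T / c < θ)
    (Ω : ℕ → Type*) [∀ n, MeasurableSpace (Ω n)]
    (P : ∀ n, Measure (Ω n)) [∀ n, IsProbabilityMeasure (P n)]
    (N : ∀ n, Ω n → ℕ) (X : ∀ n, ℕ → Ω n → ℕ)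
    (hmodel : ∀ᶠ n in atTop, IsJumpModel c θ n (P n) (N n) (X n))
    (a : ℕ → ℝ) (ha_pos : ∀ᶠ n in atTop, 0 < a n)
    (ha_lower : (fun n : ℕ => √(Real.log n)) =o[atTop] a)
    (ha_upper : a =o[atTop] fun n : ℕ => √(n : ℝ))
    (M : ℝ) (hM : 0 < M) {B : ℝ}
    (hB : B < M ^ 2 / 2 * ((1 - T) ^ 2 / ((1 - T / c) * (T / c)))) :
    ∀ᶠ n : ℕ in atTop, (P n)[
          {ω | |(maxJump (N n) (X n) ω : ℝ) - (1 - T / c) * n| ≤ M * a n * √(n : ℝ)}ᶜ |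
          {ω | totalJump (N n) (X n) ω = n}] ≤ ENNReal.ofReal (Real.exp (-(B * a n ^ 2))) := by
  classical
  -- For B ≤ 0 the claim follows from the one for half the rate.
  wlog hB0 : 0 < B generalizing B
  · obtain ⟨hT0, hT1⟩ := hT
    have hc0 : 0 < c := by linarith
    have h1 : 0 < 1 - T / c := by
      have := (div_lt_one hc0).2 (hT1.trans hc)
      linarith
    have h2 : 0 < M ^ 2 / 2 * ((1 - T) ^ 2 / ((1 - T / c) * (T / c))) := by
      have : 0 < 1 - T := by linarith
      have : 0 < T / c := by positivity
      positivity
    filter_upwards [this (half_lt_self h2) (half_pos h2)] with n hn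
    refine hn.trans (ENNReal.ofReal_le_ofReal (Real.exp_le_exp.2 ?_))
    have h3 := mul_nonneg (half_pos h2).le (sq_nonneg (a n))
    have h4 := mul_nonpos_of_nonpos_of_nonneg (not_lt.1 hB0) (sq_nonneg (a n))
    linarith
  have hc0 : 0 < c := by linarith
  have hρ0 : 0 < 1 - T / c := by
    have := (div_lt_one hc0).2 (hT.2.trans hc)
    linarith
  set J := M ^ 2 / 2 * ((1 - T) ^ 2 / ((1 - T / c) * (T / c))) with hJ
  have hJ0 : 0 < J := hB0.trans hB
  obtain ⟨ε, hε0, hερ, κ, hκ, hsmall⟩ := exists_smallProb_le_exp hc hρ0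
  obtain ⟨r, hr1, hr⟩ : ∃ r, B / J < r ∧ r < 1 := exists_between ((div_lt_one hJ0).2 hB)
  have hr0 : 0 < r := (div_pos hB0 hJ0).trans hr1
  have hrJ : 0 < r * J - B := by
    rw [div_lt_iff₀ hJ0] at hr1
    linarith
  set δ : ℕ → ℝ := fun n => M * a n / √(n : ℝ) with hδ
  have hnpos : ∀ᶠ n : ℕ in atTop, (0 : ℝ) < n :=
    tendsto_natCast_atTop_atTop.eventually (eventually_gt_atTop 0)
  have hnc : ∀ᶠ n : ℕ in atTop, c < n :=
    tendsto_natCast_atTop_atTop.eventually (eventually_gt_atTop c)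
  have hlog : Tendsto (fun n : ℕ => Real.log n) atTop atTop :=
    Real.tendsto_log_atTop.comp tendsto_natCast_atTop_atTop
  have hloga : ∀ s > 0, ∀ᶠ n : ℕ in atTop, Real.log n ≤ s * a n ^ 2 := by
    intro s hs
    filter_upwards [ha_lower.def (Real.sqrt_pos.2 hs), ha_pos, hlog.eventually_ge_atTop 0] with
      n h1 h2 h3
    rw [Real.norm_of_nonneg (Real.sqrt_nonneg _), Real.norm_of_nonneg h2.le] at h1
    have h4 := pow_le_pow_left₀ (Real.sqrt_nonneg _) h1 2
    rwa [Real.sq_sqrt h3, mul_pow, Real.sq_sqrt hs.le] at h4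
  have han : ∀ s > 0, ∀ᶠ n : ℕ in atTop, a n ^ 2 ≤ s * n := by
    intro s hs
    filter_upwards [ha_upper.def (Real.sqrt_pos.2 hs), ha_pos] with n h1 h2
    rw [Real.norm_of_nonneg (Real.sqrt_nonneg _), Real.norm_of_nonneg h2.le] at h1
    have h4 := pow_le_pow_left₀ h2.le h1 2
    rwa [mul_pow, Real.sq_sqrt hs.le, Real.sq_sqrt (Nat.cast_nonneg n)] at h4
  have ha_top : Tendsto (fun n => a n ^ 2) atTop atTop := by
    refine tendsto_atTop_mono' _ ?_ hlog
    filter_upwards [hloga 1 one_pos] with n h1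
    linarith
  have hδ0 : ∀ᶠ n in atTop, 0 < δ n := by
    filter_upwards [ha_pos, hnpos] with n h1 h2
    have := Real.sqrt_pos.2 h2
    simp only [hδ]
    positivity
  have hδlim : Tendsto δ atTop (𝓝 0) := by
    have := ha_upper.tendsto_div_nhds_zero.const_mul M
    rw [mul_zero] at this
    refine this.congr fun n => ?_
    simp only [hδ]
    ring
  have hnδ : Tendsto (fun n : ℕ => n * δ n) atTop atTop := by
    refine tendsto_atTop_mono' _ ?_ (ha_top.const_mul_atTop hM)
    filter_upwards [ha_pos, hnpos, han 1 one_pos] with n h1 h2 h3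
    have h4 := Real.sqrt_pos.2 h2
    have h5 : (n : ℝ) * δ n = M * (√(n : ℝ) * a n) := by
      simp only [hδ]
      field_simp
      rw [Real.sq_sqrt h2.le]
    have h6 : a n ≤ √(n : ℝ) := Real.le_sqrt_of_sq_le (by linarith)
    rw [h5, sq]
    gcongr
  have hmean := eventually_meanComp_le hc hT hTc hε0 hερ hr0 hr hδ0 hδlim hnδ
  -- This is where a_n ≪ √n makes the absence of a large component negligible.
  have hterm1 : ∀ᶠ n : ℕ in atTop, Real.exp (-(κ * n)) ≤ 1 / 4 * Real.exp (-(B * a n ^ 2)) := by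
    filter_upwards [han (κ / 2 / B) (by positivity),
      tendsto_natCast_atTop_atTop.eventually (eventually_ge_atTop (Real.log 4 / (κ / 2)))] with
      n h1 h2
    have h3 : (1 / 4 : ℝ) = Real.exp (-Real.log 4) := by
      rw [Real.exp_neg, Real.exp_log (by norm_num)]
      norm_num
    rw [h3, ← Real.exp_add]
    refine Real.exp_le_exp.2 ?_
    rw [div_le_iff₀ (by positivity)] at h2
    have h4 := mul_le_mul_of_nonneg_left h1 hB0.le
    have h5 : B * (κ / 2 / B * n) = κ / 2 * n := by field_simp
    linarith
  -- At most n sizes, each with prefactor n/c: the slack rJ - B > 0 absorbs n²/c since log n ≪ a_n².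
  have hterm2 : ∀ᶠ n : ℕ in atTop, (n : ℝ) * (n / c * Real.exp (-(r * J * a n ^ 2))) ≤
      1 / 4 * Real.exp (-(B * a n ^ 2)) := by
    filter_upwards [hloga ((r * J - B) / 4) (by positivity), hnpos,
      ha_top.eventually_ge_atTop (Real.log (4 / c) / ((r * J - B) / 2))] with n h1 h2 h3
    have h4 : (n : ℝ) * (n / c * Real.exp (-(r * J * a n ^ 2))) =
        1 / 4 * Real.exp (2 * Real.log n + Real.log (4 / c) - r * J * a n ^ 2) := by
      rw [sub_eq_add_neg, Real.exp_add, Real.exp_add, Real.exp_log (by positivity), two_mul,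
        Real.exp_add, Real.exp_log h2]
      ring
    rw [h4]
    gcongr
    rw [div_le_iff₀ (by positivity)] at h3
    linarith
  have hδθ : ∀ᶠ n in atTop, δ n ≤ θ - (1 - T / c) :=
    hδlim.eventually (ge_mem_nhds (by linarith))
  filter_upwards [hmodel, hnc, hsmall, hmean, hterm1, hterm2, hδθ, ha_pos] with
    n h hcn hsmall hmean hterm1 hterm2 hδθ ha0
  have hn0 : (0 : ℝ) < n := hc0.trans hcn
  have hcn1 : c / n < 1 := (div_lt_one hn0).2 hcn
  have hcn0 : 0 < c / n := by positivity
  have hsn := Real.sqrt_pos.2 hn0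
  have hPq : IsConnSeq (1 - c / n) (fun k => connProb k (c / n)) :=
    isConnSeq_connProb ⟨c / n, hcn0.le, hcn1.le⟩
  have hP : ∀ k, 0 ≤ connProb k (c / n) := fun k => connProb_nonneg k _
  have hsmall := hsmall _ hP hPq
  have hmean := hmean _ hPq
  have hexpo : r * (n * δ n ^ 2) * ((1 - T) ^ 2 / (2 * ((1 - T / c) * (T / c)))) =
      r * J * a n ^ 2 := by
    have h1 : (n : ℝ) * δ n ^ 2 = M ^ 2 * a n ^ 2 := by
      simp only [hδ]
      rw [div_pow, mul_pow, Real.sq_sqrt hn0.le]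
      field_simp
    rw [h1, hJ]
    generalize (1 - T / c) * (T / c) = w
    ring
  rw [hexpo] at hmean
  set A : Set ℕ := {l | M * a n * √(n : ℝ) < |(l : ℝ) - (1 - T / c) * n|} with hA
  have hδn : δ n * n = M * a n * √(n : ℝ) := by
    simp only [hδ]
    rw [div_mul_eq_mul_div, div_eq_iff hsn.ne', mul_assoc (M * a n), Real.mul_self_sqrt hn0.le]
  have hdist : ∀ l : ℕ, |(l : ℝ) / n - (1 - T / c)| = |(l : ℝ) - (1 - T / c) * n| / n := by
    intro l
    rw [← abs_of_pos hn0, ← abs_div, abs_of_pos hn0]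
    congr 1
    field_simp
  have hsum : ∀ F : Finset ℕ, F ⊆ Finset.Ioc 0 n →
      (∀ l ∈ F, ε * n ≤ l ∧ δ n ≤ |(l : ℝ) / n - (1 - T / c)|) →
      ∑ l ∈ F, meanComp (1 - c / n) (fun k => connProb k (c / n)) n l ≤
        1 / 4 * Real.exp (-(B * a n ^ 2)) := by
    intro F hF hFl
    refine le_trans ?_ hterm2
    refine (Finset.sum_le_card_nsmul F _ _ fun l hl => hmean l (hFl l hl).1
      (Finset.mem_Ioc.1 (hF hl)).2 (hFl l hl).2).trans ?_
    rw [nsmul_eq_mul]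
    refine mul_le_mul_of_nonneg_right ?_ (by positivity)
    have := Finset.card_le_card hF
    rw [Nat.card_Ioc, Nat.sub_zero] at this
    exact_mod_cast this
  have hlarge : ∀ F : Finset ℕ, F ⊆ Finset.Ioc ⌊ε * n⌋₊ n → ∀ l ∈ F, ε * n ≤ l := by
    intro F hF l hl
    exact ((Nat.floor_lt (by positivity)).1 (Finset.mem_Ioc.1 (hF hl)).1).le
  have hKS : ⌊ε * n⌋₊ ≤ ⌊θ * n⌋₊ := Nat.floor_le_floor (by gcongr; linarith)
  obtain ⟨C, hC0, hnum, hden⟩ := h.exists_bounds hc0 hcn A hKS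
  have hs1 := hsum ((Finset.Ioc ⌊ε * n⌋₊ n).filter (· ∈ A))
    ((Finset.filter_subset _ _).trans (Finset.Ioc_subset_Ioc_left (Nat.zero_le _)))
    fun l hl => ⟨hlarge _ (Finset.filter_subset _ _) l hl, by
      have h1 : M * a n * √(n : ℝ) < |(l : ℝ) - (1 - T / c) * n| := (Finset.mem_filter.1 hl).2
      rw [hdist, le_div_iff₀ hn0, hδn]
      exact h1.le⟩
  -- Sizes above θn are at distance at least θ - ρ ≥ δ_n from ρ after scaling, so the same bound
  -- controls the denominator.
  have hs2 := hsum (Finset.Ioc ⌊θ * n⌋₊ n) (Finset.Ioc_subset_Ioc_left (Nat.zero_le _))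
    fun l hl => ⟨hlarge _ (Finset.Ioc_subset_Ioc_left hKS) l hl, by
      have h1 : θ * n < l := (Nat.floor_lt (by
        have : 0 < θ := hρ0.trans hθ
        positivity)).1 (Finset.mem_Ioc.1 hl).1
      have h2 : θ ≤ (l : ℝ) / n := by rw [le_div_iff₀ hn0]; exact h1.le
      exact (hδθ.trans (by linarith)).trans (le_abs_self _)⟩
  have hexp1 : Real.exp (-(B * a n ^ 2)) ≤ 1 := by
    rw [Real.exp_le_one_iff]
    have := mul_nonneg hB0.le (sq_nonneg (a n))
    linarith
  have hden' : C / 2 ≤ (P n).real {ω | totalJump (N n) (X n) ω = n} := by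
    refine le_trans ?_ hden
    rw [div_eq_mul_one_div]
    exact mul_le_mul_of_nonneg_left (by linarith) hC0.le
  have hnum' : (P n).real {ω | totalJump (N n) (X n) ω = n ∧ maxJump (N n) (X n) ω ∈ A} ≤
      C / 2 * Real.exp (-(B * a n ^ 2)) := by
    refine hnum.trans ?_
    rw [show C / 2 * Real.exp (-(B * a n ^ 2)) = C * (Real.exp (-(B * a n ^ 2)) / 2) by ring]
    exact mul_le_mul_of_nonneg_left (by linarith) hC0.le
  have hmeas : MeasurableSet {ω | totalJump (N n) (X n) ω = n} := by
    have := h.measurableSet_total_max n Set.univ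
    simpa using this
  rw [cond_apply hmeas]
  have hset : {ω | totalJump (N n) (X n) ω = n} ∩
      {ω | |(maxJump (N n) (X n) ω : ℝ) - (1 - T / c) * n| ≤ M * a n * √(n : ℝ)}ᶜ =
      {ω | totalJump (N n) (X n) ω = n ∧ maxJump (N n) (X n) ω ∈ A} := by
    ext ω
    simp [hA]
  rw [hset, ← ofReal_measureReal, ← ofReal_measureReal,
    ← ENNReal.ofReal_inv_of_pos (lt_of_lt_of_le (by positivity) hden'),
    ← ENNReal.ofReal_mul (by positivity)]
  refine ENNReal.ofReal_le_ofReal ?_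
  rw [← div_eq_inv_mul, div_le_iff₀ (lt_of_lt_of_le (by positivity) hden'), mul_comm]
  exact hnum'.trans (mul_le_mul_of_nonneg_right hden' (Real.exp_pos _).le)

end SparseGraph

theorem mainTheorem4 (c T θ : ℝ) (hc : 1 < c) (hT : T ∈ Set.Ioo (0 : ℝ) 1)
    (hTc : T * Real.exp (-T) = c * Real.exp (-c)) (hθ : 1 - T / c < θ)
    (Ω : ℕ → Type*) [∀ n, MeasurableSpace (Ω n)]
    (P : ∀ n, Measure (Ω n)) [∀ n, IsProbabilityMeasure (P n)]
    (N : ∀ n, Ω n → ℕ) (X : ∀ n, ℕ → Ω n → ℕ)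
    (hmodel : ∀ᶠ n in atTop, SparseGraph.IsJumpModel c θ n (P n) (N n) (X n))
    (a : ℕ → ℝ) (ha_pos : ∀ᶠ n in atTop, 0 < a n)
    (ha_lower : (fun n : ℕ => √(Real.log n)) =o[atTop] a)
    (ha_upper : a =o[atTop] fun n : ℕ => √(n : ℝ))
    (M : ℝ) (hM : 0 < M) :
    limsup (fun n : ℕ => ((1 / a n ^ 2 : ℝ) : EReal) *
        ENNReal.log ((P n)[
          {ω | |(SparseGraph.maxJump (N n) (X n) ω : ℝ) - (1 - T / c) * n| ≤ M * a n * √(n : ℝ)}ᶜ |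
          {ω | SparseGraph.totalJump (N n) (X n) ω = n}])) atTop
      ≤ ((-(M ^ 2 / 2 * ((1 - T) ^ 2 / ((1 - T / c) * (T / c)))) : ℝ) : EReal) := by
  -- It is enough to bound the limit superior by every real z above the target, which leaves room
  -- for the loss from the constant r.
  refine EReal.le_of_forall_lt_iff_le.1 fun z hz => ?_
  have hB : -z < M ^ 2 / 2 * ((1 - T) ^ 2 / ((1 - T / c) * (T / c))) := by
    have := EReal.coe_lt_coe_iff.1 hz
    linarith
  refine limsup_le_of_le (by isBoundedDefault) ?_
  filter_upwards [SparseGraph.eventually_cond_le c T θ hc hT hTc hθ Ω P N X hmodel a ha_pos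
    ha_lower ha_upper M hM hB, ha_pos] with n hn ha0
  have h1 := ENNReal.log_le_log hn
  rw [ENNReal.log_ofReal_of_pos (Real.exp_pos _), Real.log_exp] at h1
  calc _ ≤ ((1 / a n ^ 2 : ℝ) : EReal) * ((-(-z * a n ^ 2) : ℝ) : EReal) :=
        mul_le_mul_of_nonneg_left h1 (EReal.coe_nonneg.2 (by positivity))
    _ = (z : EReal) := by
        rw [← EReal.coe_mul]
        congr 1
        field_simp
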